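/- Let $n\ge 2$ and let $F:\mathbb R^n\to[0,\infty)$ be a strongly convex Finsler norm: $F$ is even, positively $1$-homogeneous, $F\in C^2(\mathbb R^n\setminus\{0\})$, and $\nabla^2(F^2)(\xi)$ is positive definite for every $\xi\ne0$. Let $F_\circ(x)=\sup\{\xi\cdot x: F(\xi)\le 1\}$ be its polar and $\omega_{n,F}$ the Lebesgue measure of $\{F_\circ\le1\}$. Let $\Omega\subset\mathbb R^n$ be a bounded domain (open and connected) containing the origin, and $R_\Omega:=\sup_{x\in\Omega}F_\circ(x)$. Put $X_1(t):=(1-\log t)^{-1}$ for $t\in(0,1]$, $X_1(0):=0$, $X_2:=X_1\circ X_1$, and $\kappa_n:=\frac2n\left(\frac n{n-1}\right)^{n-2}$. Let $u\in W^{1,n}_0(\Omega)$ be $F_\circ$-radially symmetric, i.e. $u(x)=f(F_\circ(x))$ for a.e. $x\in\Omega$ and some function $f$. Then both integrals in $$J_F[u]:=\int_\Omega\Big|\nabla u\cdot\frac{x}{F_\circ}\Big|^n|\nabla F_\circ|\,dx-\Big(\frac{n-1}n\Big)^n\int_\Omega\frac{|u|^n}{F_\circ^n}X_1^n\Big(\frac{F_\circ}{R_\Omega}\Big)|\nabla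 F_\circ|\,dx$$ converge, $J_F[u]>0$ unless $u=0$ a.e. in $\Omega$, and $$\int_\Omega \exp\Big(\bar\gamma\Big[|u(x)|\,X_2^{1/n}\Big(\frac{F_\circ(x)}{R_\Omega}\Big)\Big]^{\frac n{n-1}}\Big)\,dx<\infty,\qquad \bar\gamma:=n\Big(\frac{4\,\omega_{n,F}}{n\,\kappa_n\,J_F[u]}\Big)^{\frac1{n-1}}$$ (for $u=0$, where $J_F[u]=0$, the exponent is understood to be $0$). In the planar Euclidean case, $n=2$ and $F=|\cdot|$, one has $\bar\gamma=4\pi/J_F[u]$ (for $u\neq0$); in particular, the integral is finite with Moser's constant $4\pi$ in place of $\bar\gamma$ whenever $J_F[u]\le1$. -/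

import Mathlib

open MeasureTheory Filter Topology

namespace LerayTrudinger

noncomputable section

/-- Euclidean space `ℝⁿ`. -/
abbrev E (n : ℕ) : Type := EuclideanSpace ℝ (Fin n)

/-- An even, positively one-homogeneous function `F : ℝⁿ → [0, ∞)` of class `C²` away from the
origin such that the Hessian of `F²` is positive definite at every nonzero point. -/
structure IsStronglyConvexFinslerNorm {n : ℕ} (F : E n → ℝ) : Prop where
  nonneg : ∀ ξ, 0 ≤ F ξ
  even : ∀ ξ, F (-ξ) = F ξ
  homogeneous : ∀ (t : ℝ) (ξ : E n), 0 < t → F (t • ξ) = t * F ξ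
  contDiffOn : ContDiffOn ℝ 2 F {0}ᶜ
  hessian_posDef : ∀ ξ : E n, ξ ≠ 0 → ∀ η : E n, η ≠ 0 →
    0 < fderiv ℝ (fderiv ℝ (fun x : E n => F x ^ 2)) ξ η η

/-- The polar `F∘(x) = sup {ξ · x : F(ξ) ≤ 1}`. -/
def polar {n : ℕ} (F : E n → ℝ) (x : E n) : ℝ :=
  sSup ((fun ξ : E n => inner ℝ ξ x) '' {ξ : E n | F ξ ≤ 1})

/-- The Lebesgue measure of the Wulff shape `{F∘ ≤ 1}`. -/
def wulffVolume {n : ℕ} (F : E n → ℝ) : ℝ :=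
  (volume : Measure (E n)).real {x : E n | polar F x ≤ 1}

/-- The anisotropic radius `R_Ω = sup_{x ∈ Ω} F∘(x)`. -/
def anisotropicRadius {n : ℕ} (F : E n → ℝ) (Ω : Set (E n)) : ℝ :=
  sSup (polar F '' Ω)

/-- `X₁(t) = (1 - log t)⁻¹` for `0 < t ≤ 1`, and `X₁(0) = 0`. -/
def X₁ (t : ℝ) : ℝ := if t = 0 then 0 else (1 - Real.log t)⁻¹

/-- `X₂ = X₁ ∘ X₁`. -/
def X₂ (t : ℝ) : ℝ := X₁ (X₁ t)

/-- `φ ∈ C_c^∞(Ω)`. -/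
structure IsTestFunction {n : ℕ} (Ω : Set (E n)) (φ : E n → ℝ) : Prop where
  smooth : ContDiff ℝ (⊤ : ℕ∞) φ
  hasCompactSupport : HasCompactSupport φ
  tsupport_subset : tsupport φ ⊆ Ω

/-- `u ∈ W^{1,p}(Ω)` with weak gradient `Du`. -/
structure MemSobolev {n : ℕ} (Ω : Set (E n)) (p : ENNReal) (u : E n → ℝ) (Du : E n → E n) :
    Prop where
  memLp : MemLp u p (volume.restrict Ω)
  memLp_grad : MemLp Du p (volume.restrict Ω)
  weak_grad : ∀ φ : E n → ℝ, IsTestFunction Ω φ →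
    ∫ x in Ω, u x • gradient φ x = - ∫ x in Ω, φ x • Du x

/-- `u ∈ W₀^{1,p}(Ω)` with weak gradient `Du`: `u` lies in the closure of `C_c^∞(Ω)` in the norm of
`W^{1,p}(Ω)`. -/
structure MemSobolevZero {n : ℕ} (Ω : Set (E n)) (p : ENNReal) (u : E n → ℝ) (Du : E n → E n) :
    Prop extends MemSobolev Ω p u Du where
  approx : ∃ φ : ℕ → E n → ℝ, (∀ k, IsTestFunction Ω (φ k)) ∧
    Tendsto (fun k => eLpNorm (fun x => φ k x - u x) p (volume.restrict Ω)) atTop (𝓝 0) ∧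
    Tendsto (fun k => eLpNorm (fun x => gradient (φ k) x - Du x) p (volume.restrict Ω))
      atTop (𝓝 0)

/-- `u` is `F∘`-radially symmetric on `Ω`: it is (almost everywhere) a function of `F∘`. -/
def IsPolarRadial {n : ℕ} (F : E n → ℝ) (Ω : Set (E n)) (u : E n → ℝ) : Prop :=
  ∃ f : ℝ → ℝ, ∀ᵐ x ∂(volume.restrict Ω), u x = f (polar F x)

/-- The integrand `|∇u · x / F∘|ⁿ |∇F∘|`. -/
def radialEnergyDensity {n : ℕ} (F : E n → ℝ) (Du : E n → E n) (x : E n) : ℝ :=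
  |inner ℝ (Du x) ((polar F x)⁻¹ • x)| ^ n * ‖gradient (polar F) x‖

/-- The integrand `|u|ⁿ / F∘ⁿ · X₁(F∘ / R_Ω)ⁿ · |∇F∘|`. -/
def hardyDensity {n : ℕ} (F : E n → ℝ) (Ω : Set (E n)) (u : E n → ℝ) (x : E n) : ℝ :=
  |u x| ^ n / polar F x ^ n * X₁ (polar F x / anisotropicRadius F Ω) ^ n *
    ‖gradient (polar F) x‖

/-- The radial Hardy difference `J_F[u]` with respect to the measure `|∇F∘| dx`. -/
def radialHardyDifference {n : ℕ} (F : E n → ℝ) (Ω : Set (E n)) (u : E n → ℝ)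
    (Du : E n → E n) : ℝ :=
  (∫ x in Ω, radialEnergyDensity F Du x) -
    (((n : ℝ) - 1) / n) ^ n * ∫ x in Ω, hardyDensity F Ω u x

/-- `κₙ = (2 / n) (n / (n - 1))^(n - 2)`. -/
def kappa (n : ℕ) : ℝ := 2 / (n : ℝ) * ((n : ℝ) / ((n : ℝ) - 1)) ^ (n - 2)

/-- `γ̄ = n (4 ω_{n,F} / (n κₙ J_F[u]))^(1 / (n - 1))`. -/
def gammaBar {n : ℕ} (F : E n → ℝ) (Ω : Set (E n)) (u : E n → ℝ) (Du : E n → E n) : ℝ :=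
  (n : ℝ) * (4 * wulffVolume F / ((n : ℝ) * kappa n * radialHardyDifference F Ω u Du)) ^
    (1 / ((n : ℝ) - 1))

/-- The function `exp (γ [|u| X₂(F∘ / R_Ω)^(1 / n)]^(n / (n - 1)))`. -/
def expIntegrand {n : ℕ} (F : E n → ℝ) (Ω : Set (E n)) (γ : ℝ) (u : E n → ℝ) (x : E n) : ℝ :=
  Real.exp (γ * (|u x| * X₂ (polar F x / anisotropicRadius F Ω) ^ (1 / (n : ℝ))) ^
    ((n : ℝ) / ((n : ℝ) - 1)))

end

end LerayTrudinger

/-! The statement splits into a Hardy inequality and an exponential integrability statement, which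
do not depend on each other. Strong convexity enters only through compactness: $F$ is comparable
with the Euclidean norm, so the polar is a positively homogeneous Lipschitz function comparable with
it (`IsLipschitzGauge`), and nothing more about $F$ is needed.

Positivity of $J_F$. Along a ray through $\theta$ the gauge is linear and $|\nabla F_\circ|$ is
constant, so in polar coordinates both integrands reduce to one-dimensional ones. There Young's
inequality, together with the derivative of $|g|^n\log(r/\rho)^{-(n-1)}$, gives Hardy's inequality
with the sharp factor $((n-1)/n)^n$ and the singular weight $(\rho\log(r/\rho))^{-n}$. Minkowski and
Fatou carry it from test functions to $W_0^{1,n}(\Omega)$ (`hardy_sobolev`). The weight in $J_F$ has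
$1+\log(R_\Omega/F_\circ)$ in place of $\log(R_\Omega/F_\circ)$ and is therefore strictly smaller:
the Hardy integral converges, and $J_F[u]>0$ unless $u=0$ a.e.

Exponential integrability. It holds for every constant $\gamma$, so the value of $\bar\gamma$ plays
no role. Trudinger's inequality provides some exponent, which improves as the gradient norm shrinks
(`exists_trudinger`). By density $u$ is a bounded test function plus a remainder of arbitrarily
small gradient norm, so any $\gamma$ can be reached (`MemSobolevZero.integrableOn_exp`); the weight
$X_2^{1/n}\le1$ only makes the integrand smaller. Trudinger's inequality itself comes from the $L^1$
Sobolev inequality applied to truncations between successive levels: Hölder bounds each ratio of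
superlevel measures by the energy between the levels, and AM-GM bounds the product of these ratios.
-/

namespace LerayTrudinger

open scoped NNReal ENNReal

/-! ### Finsler norms and their polars as Lipschitz gauges -/

/-- A positively homogeneous Lipschitz function comparable with the Euclidean norm. -/
structure IsLipschitzGauge {n : ℕ} (N : E n → ℝ) (a : ℝ) (K : ℝ≥0) : Prop where
  pos : 0 < a
  lower : ∀ x, a * ‖x‖ ≤ N x
  lipschitz : LipschitzWith K N
  homogeneous : ∀ (t : ℝ) (x : E n), 0 < t → N (t • x) = t * N x

/-- The second derivative along a ray of a function that vanishes on the ray. -/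
lemma hessian_apply_eq_zero_of_ray {n : ℕ} {G : E n → ℝ} {ξ : E n} (hξ : ξ ≠ 0)
    (hG : ContDiffOn ℝ 2 G {0}ᶜ) (hzero : ∀ t : ℝ, 0 < t → G (t • ξ) = 0) :
    fderiv ℝ (fderiv ℝ G) ξ ξ ξ = 0 := by
  have hopen : IsOpen ({0}ᶜ : Set (E n)) := isOpen_compl_singleton
  have hmem : ∀ t : ℝ, 0 < t → t • ξ ∈ ({0}ᶜ : Set (E n)) := fun t ht => by
    simp [ht.ne', hξ]
  have hcurve : ∀ t : ℝ, HasDerivAt (fun s : ℝ => s • ξ) ξ t := fun t => by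
    simpa using (hasDerivAt_id t).smul_const ξ
  have hfirst : ∀ t : ℝ, 0 < t → fderiv ℝ G (t • ξ) ξ = 0 := by
    intro t ht
    have hd : HasFDerivAt G (fderiv ℝ G (t • ξ)) (t • ξ) :=
      ((hG.contDiffAt (hopen.mem_nhds (hmem t ht))).differentiableAt (by norm_num)).hasFDerivAt
    have h1 : HasDerivAt (G ∘ fun s : ℝ => s • ξ) (fderiv ℝ G (t • ξ) ξ) t :=
      hd.comp_hasDerivAt t (hcurve t)
    have h2 : HasDerivAt (G ∘ fun s : ℝ => s • ξ) 0 t := by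
      refine (hasDerivAt_const t (0 : ℝ)).congr_of_eventuallyEq ?_
      filter_upwards [lt_mem_nhds ht] with s hs using hzero s hs
    exact h1.unique h2
  have hd2 : HasFDerivAt (fderiv ℝ G) (fderiv ℝ (fderiv ℝ G) ξ) ((1 : ℝ) • ξ) := by
    have hcd : ContDiffAt ℝ 2 G ξ := hG.contDiffAt (hopen.mem_nhds (by simpa using hξ))
    rw [one_smul]
    exact ((hcd.fderiv_right (m := 1) (by norm_num)).differentiableAt (by norm_num)).hasFDerivAt
  have h0 : HasDerivAt (fderiv ℝ G ∘ fun s : ℝ => s • ξ) (fderiv ℝ (fderiv ℝ G) ξ ξ) 1 :=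
    hd2.comp_hasDerivAt (1 : ℝ) (hcurve 1)
  have h1 : HasDerivAt (fun s : ℝ => fderiv ℝ G (s • ξ) ξ)
      (fderiv ℝ (fderiv ℝ G) ξ ξ ξ) 1 := by
    simpa using h0.clm_apply (hasDerivAt_const (1 : ℝ) ξ)
  have h2 : HasDerivAt (fun s : ℝ => fderiv ℝ G (s • ξ) ξ) 0 1 := by
    refine (hasDerivAt_const (1 : ℝ) (0 : ℝ)).congr_of_eventuallyEq ?_
    filter_upwards [lt_mem_nhds one_pos] with s hs using hfirst s hs
  exact h1.unique h2

namespace IsStronglyConvexFinslerNorm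

variable {n : ℕ} {F : E n → ℝ}

lemma map_zero (hF : IsStronglyConvexFinslerNorm F) : F 0 = 0 := by
  have h := hF.homogeneous 2 0 (by norm_num)
  rw [smul_zero] at h
  linarith

/-- A zero of $F$ would spread along its ray by homogeneity, and the Hessian of $F^2$ would then
degenerate in the radial direction. -/
lemma pos (hF : IsStronglyConvexFinslerNorm F) {ξ : E n} (hξ : ξ ≠ 0) : 0 < F ξ := by
  refine lt_of_le_of_ne (hF.nonneg ξ) fun h0 => ?_
  have h1 := hF.hessian_posDef ξ hξ ξ hξ
  rw [hessian_apply_eq_zero_of_ray hξ (hF.contDiffOn.pow 2) fun t ht => ?_] at h1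
  · exact lt_irrefl _ h1
  · simp [hF.homogeneous t ξ ht, ← h0]

lemma exists_bounds (hn : 2 ≤ n) (hF : IsStronglyConvexFinslerNorm F) :
    ∃ c C : ℝ, 0 < c ∧ 0 < C ∧ ∀ ξ, c * ‖ξ‖ ≤ F ξ ∧ F ξ ≤ C * ‖ξ‖ := by
  have : Nonempty (Fin n) := ⟨⟨0, by omega⟩⟩
  have hcomp : IsCompact (Metric.sphere (0 : E n) 1) := isCompact_sphere _ _
  have hne : (Metric.sphere (0 : E n) 1).Nonempty := by
    simp
  have hcont : ContinuousOn F (Metric.sphere (0 : E n) 1) := by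
    refine hF.contDiffOn.continuousOn.mono fun x hx => ?_
    have : ‖x‖ = 1 := by simpa using hx
    rintro rfl
    simp at this
  obtain ⟨y, hy, hmin⟩ := hcomp.exists_isMinOn hne hcont
  obtain ⟨z, hz, hmax⟩ := hcomp.exists_isMaxOn hne hcont
  have hsne : ∀ x ∈ Metric.sphere (0 : E n) 1, x ≠ 0 := by
    rintro x hx rfl
    simp at hx
  refine ⟨F y, F z, hF.pos (hsne y hy), hF.pos (hsne z hz), fun ξ => ?_⟩
  rcases eq_or_ne ξ 0 with rfl | hξ
  · simp [hF.map_zero]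
  have hpos : 0 < ‖ξ‖ := norm_pos_iff.2 hξ
  have hs : ‖ξ‖⁻¹ • ξ ∈ Metric.sphere (0 : E n) 1 := by
    simp [norm_smul, hpos.ne']
  have h1 : F ξ = F (‖ξ‖⁻¹ • ξ) * ‖ξ‖ := by
    rw [hF.homogeneous _ _ (inv_pos.2 hpos)]
    field_simp
  rw [h1]
  exact ⟨mul_le_mul_of_nonneg_right (hmin hs) hpos.le,
    mul_le_mul_of_nonneg_right (hmax hs) hpos.le⟩

/-- The polar is a supremum of linear functionals with uniformly bounded slopes, hence Lipschitz;
testing with a multiple of $x$ itself gives the lower bound. -/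
lemma exists_isLipschitzGauge_polar (hn : 2 ≤ n) (hF : IsStronglyConvexFinslerNorm F) :
    ∃ a K, IsLipschitzGauge (polar F) a K := by
  obtain ⟨c, C, hc, hC, hb⟩ := hF.exists_bounds hn
  have hle : ∀ ξ x : E n, F ξ ≤ 1 → inner ℝ ξ x ≤ c⁻¹ * ‖x‖ := by
    intro ξ x hξ
    refine (real_inner_le_norm ξ x).trans (mul_le_mul_of_nonneg_right ?_ (norm_nonneg _))
    rw [← mul_one c⁻¹, ← div_eq_inv_mul, le_div_iff₀ hc, mul_comm]
    exact (hb ξ).1.trans hξ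
  have hbdd : ∀ x : E n, BddAbove ((fun ξ : E n => inner ℝ ξ x) '' {ξ : E n | F ξ ≤ 1}) := by
    rintro x
    refine ⟨c⁻¹ * ‖x‖, ?_⟩
    rintro _ ⟨ξ, hξ, rfl⟩
    exact hle ξ x hξ
  have hne : ∀ x : E n, ((fun ξ : E n => inner ℝ ξ x) '' {ξ : E n | F ξ ≤ 1}).Nonempty :=
    fun x => ⟨_, 0, by simp [hF.map_zero], rfl⟩
  have hinner : ∀ ξ x : E n, F ξ ≤ 1 → inner ℝ ξ x ≤ polar F x := fun ξ x hξ =>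
    le_csSup (hbdd x) ⟨ξ, hξ, rfl⟩
  have hpolar_le : ∀ (x : E n) (m : ℝ), (∀ ξ, F ξ ≤ 1 → inner ℝ ξ x ≤ m) → polar F x ≤ m := by
    intro x m h
    refine csSup_le (hne x) ?_
    rintro _ ⟨ξ, hξ, rfl⟩
    exact h ξ hξ
  have hhom : ∀ (t : ℝ) (x : E n), 0 < t → polar F (t • x) = t * polar F x := by
    intro t x ht
    apply le_antisymm
    · refine hpolar_le _ _ fun ξ hξ => ?_
      rw [inner_smul_right]
      exact mul_le_mul_of_nonneg_left (hinner ξ x hξ) ht.le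
    · rw [← le_div_iff₀' ht]
      refine hpolar_le _ _ fun ξ hξ => ?_
      rw [le_div_iff₀' ht, ← inner_smul_right]
      exact hinner ξ _ hξ
  refine ⟨C⁻¹, Real.toNNReal c⁻¹, inv_pos.2 hC, fun x => ?_, ?_, hhom⟩
  · rcases eq_or_ne x 0 with rfl | hx
    · simpa using hinner 0 0 (by simp [hF.map_zero])
    have hpos : 0 < ‖x‖ := norm_pos_iff.2 hx
    have h := hinner ((C * ‖x‖)⁻¹ • x) x (by
      rw [hF.homogeneous _ _ (by positivity), inv_mul_le_iff₀ (by positivity), mul_one]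
      exact (hb x).2)
    rw [inner_smul_left, real_inner_self_eq_norm_sq] at h
    refine le_of_eq_of_le ?_ h
    simp
    field_simp
  · refine LipschitzWith.of_le_add_mul _ fun x y => hpolar_le _ _ fun ξ hξ => ?_
    have h1 := hinner ξ y hξ
    have h2 := hle ξ (x - y) hξ
    rw [inner_sub_right] at h2
    rw [dist_eq_norm]
    rw [Real.coe_toNNReal _ (inv_pos.2 hc).le]
    linarith

end IsStronglyConvexFinslerNorm

/-! ### The gradient of a gauge -/

namespace IsLipschitzGauge

variable {n : ℕ} {N : E n → ℝ} {a : ℝ} {K : ℝ≥0}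

lemma map_zero (h : IsLipschitzGauge N a K) : N 0 = 0 := by
  have := h.homogeneous 2 0 (by norm_num)
  rw [smul_zero] at this
  linarith

lemma nonneg (h : IsLipschitzGauge N a K) (x : E n) : 0 ≤ N x :=
  (mul_nonneg h.pos.le (norm_nonneg x)).trans (h.lower x)

lemma map_pos (h : IsLipschitzGauge N a K) {x : E n} (hx : x ≠ 0) : 0 < N x :=
  (mul_pos h.pos (norm_pos_iff.2 hx)).trans_le (h.lower x)

lemma le_norm (h : IsLipschitzGauge N a K) (x : E n) : N x ≤ K * ‖x‖ := by
  have := h.lipschitz.dist_le_mul x 0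
  rw [h.map_zero, Real.dist_eq, sub_zero, dist_zero_right] at this
  exact (le_abs_self _).trans this

lemma measurable (h : IsLipschitzGauge N a K) : Measurable N :=
  h.lipschitz.continuous.measurable

lemma norm_gradient_eq (x : E n) : ‖gradient N x‖ = ‖fderiv ℝ N x‖ := by
  simp [gradient]

lemma norm_gradient_le (h : IsLipschitzGauge N a K) (x : E n) : ‖gradient N x‖ ≤ K := by
  rw [norm_gradient_eq]
  exact norm_fderiv_le_of_lipschitz ℝ h.lipschitz

lemma measurable_norm_gradient : Measurable fun x => ‖gradient N x‖ := by
  simp only [norm_gradient_eq]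
  exact (measurable_fderiv ℝ N).norm

/-- The gradient of a one-homogeneous function is zero-homogeneous. No differentiability is
required: the scaling rules used also hold for the default value of `fderiv`. -/
lemma norm_gradient_smul (h : IsLipschitzGauge N a K) {t : ℝ} (ht : 0 < t) (x : E n) :
    ‖gradient N (t • x)‖ = ‖gradient N x‖ := by
  have hfun : N = fun y => t⁻¹ • N (t • y) := by
    funext y
    rw [h.homogeneous t y ht, smul_eq_mul, inv_mul_cancel_left₀ ht.ne']
  have h1 : fderiv ℝ (fun y => N (t • y)) x = t • fderiv ℝ N (t • x) := by
    rw [fderiv_comp_smul]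
  have h2 : fderiv ℝ (fun y => N (t • y)) x = t • fderiv ℝ N x := by
    have : (fun y => N (t • y)) = fun y => t • N y := by
      funext y
      rw [h.homogeneous t y ht, smul_eq_mul]
    rw [this]
    exact congrFun (fderiv_const_smul_field t) x
  rw [norm_gradient_eq, norm_gradient_eq]
  have h3 := h1.symm.trans h2
  rw [smul_right_injective _ ht.ne' h3]

/-- Rademacher's theorem and Euler's identity $\nabla N(x)\cdot x=N(x)>0$. This lets the measure
$|\nabla F_\circ|\,dx$ detect all sets of positive measure. -/
lemma ae_norm_gradient_pos [NeZero n] (h : IsLipschitzGauge N a K) :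
    ∀ᵐ x : E n, 0 < ‖gradient N x‖ := by
  have hne : ∀ᵐ x : E n, x ≠ 0 := by
    have : Nontrivial (E n) := by
      have : Nonempty (Fin n) := ⟨0⟩
      infer_instance
    simp [ae_iff]
  filter_upwards [h.lipschitz.ae_differentiableAt, hne] with x hx hx0
  rw [norm_gradient_eq, norm_pos_iff]
  intro h0
  have hcurve : HasDerivAt (fun s : ℝ => s • x) x 1 := by
    simpa using (hasDerivAt_id (1 : ℝ)).smul_const x
  have h1 : HasDerivAt (fun s : ℝ => N (s • x)) (fderiv ℝ N ((1 : ℝ) • x) x) 1 :=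
    HasFDerivAt.comp_hasDerivAt (1 : ℝ) (by rw [one_smul]; exact hx.hasFDerivAt) hcurve
  have h2 : HasDerivAt (fun s : ℝ => N (s • x)) (N x) 1 := by
    have : HasDerivAt (fun s : ℝ => s * N x) (N x) 1 := by
      simpa using (hasDerivAt_id (1 : ℝ)).mul_const (N x)
    refine this.congr_of_eventuallyEq ?_
    filter_upwards [lt_mem_nhds one_pos] with s hs using h.homogeneous s x hs
  have h3 := h1.unique h2
  rw [one_smul, h0] at h3
  exact (h.map_pos hx0).ne h3

end IsLipschitzGauge

/-! ### The one-dimensional Hardy inequality -/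

/-- Bernoulli's inequality at $a/b-1$, multiplied by $b^{m+1}$. -/
lemma young_pow_succ (m : ℕ) {a b : ℝ} (ha : 0 ≤ a) (hb : 0 ≤ b) :
    (m + 1) * (a * b ^ m) ≤ a ^ (m + 1) + m * b ^ (m + 1) := by
  rcases hb.eq_or_lt with rfl | hb
  · rcases m with _ | m <;> simp; positivity
  have h := one_add_mul_le_pow (a := a / b - 1) (by have := div_nonneg ha hb.le; linarith) (m + 1)
  rw [add_sub_cancel, div_pow, le_div_iff₀ (by positivity)] at h
  push_cast at h
  have h2 : (1 + (m + 1 : ℝ) * (a / b - 1)) * b ^ (m + 1)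
      = (m + 1) * (a * b ^ m) - m * b ^ (m + 1) := by
    field_simp
    ring
  linarith

lemma hasDerivAt_abs_pow (m : ℕ) (x : ℝ) :
    HasDerivAt (fun x : ℝ => |x| ^ (m + 2)) ((m + 2) * (|x| ^ m * x)) x := by
  have h := hasDerivAt_abs_rpow x (p := ((m + 2 : ℕ) : ℝ)) (by push_cast; linarith [m.cast_nonneg (α := ℝ)])
  simp only [Real.rpow_natCast] at h
  have h2 : ((m + 2 : ℕ) : ℝ) - 2 = (m : ℕ) := by push_cast; ring
  rw [h2, Real.rpow_natCast] at h
  convert h using 1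
  push_cast
  ring

/-- Pointwise form of the one-dimensional Hardy inequality, with `l = log (r / ρ)`. -/
lemma hardy_pointwise (m : ℕ) {g g' ρ l q : ℝ} (hρ : 0 < ρ) (hl : 0 < l)
    (hq : q = (m + 1) / (m + 2)) :
    q ^ (m + 2) * (|g| ^ (m + 2) / (ρ * l) ^ (m + 2)) * ρ ^ (m + 1) ≤
      |g'| ^ (m + 2) * ρ ^ (m + 1) +
        q ^ (m + 1) * ((m + 2) * (|g| ^ m * g) * g' * (l ^ (m + 1))⁻¹ +
          |g| ^ (m + 2) * ((m + 1) * l ^ m * ρ⁻¹ / (l ^ (m + 1)) ^ 2)) := by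
  have hq0 : 0 < q := by rw [hq]; positivity
  have hq' : q * (m + 2) = m + 1 := by rw [hq]; field_simp
  -- After the factor $\rho^{-1}$ is taken out, every term is a monomial in $A=|g'|\rho$ and
  -- $B=q|g|/l$. With $n=m+2$ and $nq=n-1$, the claim follows from $B^n\le A^n-nAB^{n-1}+nB^n$,
  -- which is Young's inequality.
  have hY := young_pow_succ (m + 1) (a := |g'| * ρ) (b := q * |g| / l) (by positivity)
    (by positivity)
  push_cast at hY
  have hs : -(|g| ^ (m + 1) * |g'|) ≤ |g| ^ m * g * g' := by
    have : |(|g| ^ m * g * g')| = |g| ^ (m + 1) * |g'| := by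
      rw [abs_mul, abs_mul, abs_pow, abs_abs]; ring
    rw [← this]
    exact neg_abs_le _
  have h1 : q ^ (m + 1) * ((m + 2) * (-(|g| ^ (m + 1) * |g'|)) * (l ^ (m + 1))⁻¹) ≤
      q ^ (m + 1) * ((m + 2) * (|g| ^ m * g * g') * (l ^ (m + 1))⁻¹) := by gcongr
  have e1 : q ^ (m + 2) * (|g| ^ (m + 2) / (ρ * l) ^ (m + 2)) * ρ ^ (m + 1)
      = (q * |g| / l) ^ (m + 2) * ρ⁻¹ := by
    simp only [mul_pow, div_pow]
    field_simp
    ring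
  have e2 : q ^ (m + 1) * (|g| ^ (m + 2) * ((m + 1) * l ^ m * ρ⁻¹ / (l ^ (m + 1)) ^ 2))
      = (m + 2) * (q * |g| / l) ^ (m + 2) * ρ⁻¹ := by
    rw [← hq']
    simp only [mul_pow, div_pow]
    field_simp
    ring
  have e3 : q ^ (m + 1) * ((m + 2) * (-(|g| ^ (m + 1) * |g'|)) * (l ^ (m + 1))⁻¹)
      = -((m + 2) * (|g'| * ρ * (q * |g| / l) ^ (m + 1))) * ρ⁻¹ := by
    simp only [mul_pow, div_pow]
    field_simp
  have e4 : |g'| ^ (m + 2) * ρ ^ (m + 1) = (|g'| * ρ) ^ (m + 2) * ρ⁻¹ := by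
    rw [mul_pow]
    field_simp
    ring
  have h2 : (m + 1 + 1) * (|g'| * ρ * (q * |g| / l) ^ (m + 1)) * ρ⁻¹ ≤
      ((|g'| * ρ) ^ (m + 1 + 1) + (m + 1) * (q * |g| / l) ^ (m + 1 + 1)) * ρ⁻¹ := by gcongr
  rw [e3] at h1
  rw [mul_add, e1, e2, e4]
  have e5 : q ^ (m + 1) * ((m + 2) * (|g| ^ m * g) * g' * (l ^ (m + 1))⁻¹)
      = q ^ (m + 1) * ((m + 2) * (|g| ^ m * g * g') * (l ^ (m + 1))⁻¹) := by ring
  rw [e5]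
  ring_nf at h1 h2 ⊢
  linarith

/-- Hardy's inequality on an interval `(ε, b)` with `b < r`. -/
lemma hardy_Ioc (m : ℕ) {g : ℝ → ℝ} (hg : ContDiff ℝ 1 g) {r ε b q : ℝ} (hε : 0 < ε)
    (hεb : ε ≤ b) (hb : b < r) (hgb : g b = 0) (hq : q = (m + 1) / (m + 2)) :
    ∫⁻ ρ in Set.Ioc ε b,
      ENNReal.ofReal (q ^ (m + 2) * (|g ρ| ^ (m + 2) / (ρ * Real.log (r / ρ)) ^ (m + 2)) *
        ρ ^ (m + 1)) ≤
      ∫⁻ ρ in Set.Ioc ε b, ENNReal.ofReal (|deriv g ρ| ^ (m + 2) * ρ ^ (m + 1)) := by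
  have hq0 : 0 < q := by rw [hq]; positivity
  have hpos : ∀ ρ ∈ Set.Icc ε b, 0 < ρ := fun ρ h => hε.trans_le h.1
  have hlog : ∀ ρ ∈ Set.Icc ε b, 0 < Real.log (r / ρ) := fun ρ h =>
    Real.log_pos ((one_lt_div (hpos ρ h)).2 (h.2.trans_lt hb))
  have hr : 0 < r := (hε.trans_le hεb).trans hb
  set B : ℝ → ℝ := fun ρ => q ^ (m + 2) *
    (|g ρ| ^ (m + 2) / (ρ * Real.log (r / ρ)) ^ (m + 2)) * ρ ^ (m + 1) with hB
  set A : ℝ → ℝ := fun ρ => |deriv g ρ| ^ (m + 2) * ρ ^ (m + 1) with hA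
  -- The derivative of $q^{m+1}|g|^{m+2}\log(r/\rho)^{-(m+1)}$, whose integral is a pure boundary
  -- term.
  set P : ℝ → ℝ := fun ρ => q ^ (m + 1) *
    ((m + 2) * (|g ρ| ^ m * g ρ) * deriv g ρ * (Real.log (r / ρ) ^ (m + 1))⁻¹ +
      |g ρ| ^ (m + 2) * ((m + 1) * Real.log (r / ρ) ^ m * ρ⁻¹ /
        (Real.log (r / ρ) ^ (m + 1)) ^ 2)) with hP
  have hgc : ContinuousOn g (Set.Icc ε b) := hg.continuous.continuousOn
  have hgc' : ContinuousOn (deriv g) (Set.Icc ε b) :=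
    (hg.continuous_deriv le_rfl).continuousOn
  have hlc : ContinuousOn (fun ρ => Real.log (r / ρ)) (Set.Icc ε b) :=
    (continuousOn_const.div continuousOn_id fun ρ h => (hpos ρ h).ne').log
      fun ρ h => (div_pos hr (hpos ρ h)).ne'
  have hinv : ContinuousOn (fun ρ : ℝ => ρ⁻¹) (Set.Icc ε b) :=
    continuousOn_id.inv₀ fun ρ h => (hpos ρ h).ne'
  have hBc : ContinuousOn B (Set.Icc ε b) := by
    refine (continuousOn_const.mul ((hgc.abs.pow _).div ((continuousOn_id.mul hlc).pow _)
      fun ρ h => ?_)).mul (continuousOn_id.pow _)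
    exact pow_ne_zero _ (mul_pos (hpos ρ h) (hlog ρ h)).ne'
  have hAc : ContinuousOn A (Set.Icc ε b) := (hgc'.abs.pow _).mul (continuousOn_id.pow _)
  have hPc : ContinuousOn P (Set.Icc ε b) := by
    refine continuousOn_const.mul (ContinuousOn.add ?_ ?_)
    · exact ((continuousOn_const.mul ((hgc.abs.pow _).mul hgc)).mul hgc').mul
        ((hlc.pow _).inv₀ fun ρ h => pow_ne_zero _ (hlog ρ h).ne')
    · exact (hgc.abs.pow _).mul (((continuousOn_const.mul (hlc.pow _)).mul hinv).div
        ((hlc.pow _).pow _) fun ρ h => pow_ne_zero _ (pow_ne_zero _ (hlog ρ h).ne'))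
  have hderiv : ∀ ρ ∈ Set.uIcc ε b, HasDerivAt
      (fun ρ => q ^ (m + 1) * (|g ρ| ^ (m + 2) * (Real.log (r / ρ) ^ (m + 1))⁻¹)) (P ρ) ρ := by
    intro ρ hρ
    rw [Set.uIcc_of_le hεb] at hρ
    have hρ0 := hpos ρ hρ
    have hl := hlog ρ hρ
    have hdg : HasDerivAt g (deriv g ρ) ρ := (hg.differentiable (by norm_num) ρ).hasDerivAt
    have h1 : HasDerivAt (fun ρ => |g ρ| ^ (m + 2))
        ((m + 2) * (|g ρ| ^ m * g ρ) * deriv g ρ) ρ :=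
      HasDerivAt.comp (h₂ := fun x : ℝ => |x| ^ (m + 2)) ρ (hasDerivAt_abs_pow m (g ρ)) hdg
    have h2 : HasDerivAt (fun ρ => Real.log (r / ρ)) (-ρ⁻¹) ρ := by
      have h3 : HasDerivAt (fun ρ => Real.log r - Real.log ρ) (-ρ⁻¹) ρ := by
        simpa using (Real.hasDerivAt_log hρ0.ne').const_sub (Real.log r)
      refine h3.congr_of_eventuallyEq ?_
      filter_upwards [lt_mem_nhds hρ0] with s hs
      rw [Real.log_div hr.ne' hs.ne']
    have h4 := (h2.pow (m + 1)).inv (pow_ne_zero _ hl.ne')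
    have h5 := (h1.mul h4).const_mul (q ^ (m + 1))
    refine HasDerivAt.congr_deriv h5 ?_
    simp only [hP, Pi.pow_apply, Pi.inv_apply, Nat.add_sub_cancel]
    push_cast
    ring
  have hint : ∀ f : ℝ → ℝ, ContinuousOn f (Set.Icc ε b) → IntervalIntegrable f volume ε b :=
    fun f hf => (hf.mono (by rw [Set.uIcc_of_le hεb])).intervalIntegrable
  have hFTC := intervalIntegral.integral_eq_sub_of_hasDerivAt hderiv (hint P hPc)
  have hmono : ∫ ρ in ε..b, B ρ ≤ ∫ ρ in ε..b, (A ρ + P ρ) :=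
    intervalIntegral.integral_mono_on hεb (hint B hBc) (hint _ (hAc.add hPc)) fun ρ h =>
      hardy_pointwise m (hpos ρ h) (hlog ρ h) hq
  rw [intervalIntegral.integral_add (hint A hAc) (hint P hPc), hFTC, hgb] at hmono
  -- The boundary term vanishes at $b$, and at $\varepsilon$ it has the favourable sign, so no
  -- information on $g$ near $0$ is needed.
  have hle : ∫ ρ in ε..b, B ρ ≤ ∫ ρ in ε..b, A ρ := by
    have h0 : 0 ≤ q ^ (m + 1) * (|g ε| ^ (m + 2) * (Real.log (r / ε) ^ (m + 1))⁻¹) := by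
      have := hlog ε ⟨le_rfl, hεb⟩
      positivity
    simp only [abs_zero, ne_eq, Nat.add_eq_zero_iff, OfNat.ofNat_ne_zero, and_false,
      not_false_eq_true, zero_pow, zero_mul, mul_zero] at hmono
    linarith
  rw [intervalIntegral.integral_of_le hεb, intervalIntegral.integral_of_le hεb] at hle
  have hBn : 0 ≤ᵐ[volume.restrict (Set.Ioc ε b)] B := by
    filter_upwards [ae_restrict_mem measurableSet_Ioc] with ρ hρ
    have h1 := hpos ρ ⟨hρ.1.le, hρ.2⟩
    have h2 := hlog ρ ⟨hρ.1.le, hρ.2⟩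
    simp only [hB, Pi.zero_apply]
    positivity
  have hAn : 0 ≤ᵐ[volume.restrict (Set.Ioc ε b)] A := by
    filter_upwards [ae_restrict_mem measurableSet_Ioc] with ρ hρ
    have h1 := hpos ρ ⟨hρ.1.le, hρ.2⟩
    simp only [hA, Pi.zero_apply]
    positivity
  rw [← ofReal_integral_eq_lintegral_ofReal (hint B hBc).1 hBn,
    ← ofReal_integral_eq_lintegral_ofReal (hint A hAc).1 hAn]
  exact ENNReal.ofReal_le_ofReal hle

/-- Hardy's inequality on a ray, for functions vanishing on `[b, ∞)` with `b < r`. -/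
lemma hardy_Ioi (m : ℕ) {g : ℝ → ℝ} (hg : ContDiff ℝ 1 g) {r b q : ℝ}
    (hb : b < r) (hgb : ∀ ρ, b ≤ ρ → g ρ = 0) (hq : q = (m + 1) / (m + 2)) :
    ∫⁻ ρ in Set.Ioi 0,
      ENNReal.ofReal (q ^ (m + 2) * (|g ρ| ^ (m + 2) / (ρ * Real.log (r / ρ)) ^ (m + 2)) *
        ρ ^ (m + 1)) ≤
      ∫⁻ ρ in Set.Ioi 0, ENNReal.ofReal (|deriv g ρ| ^ (m + 2) * ρ ^ (m + 1)) := by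
  -- Exhaustion of the half-line: the bound on $(\varepsilon,b]$ has no loss in $\varepsilon$, so
  -- monotone convergence suffices.
  have hU : Set.Ioi (0 : ℝ) = ⋃ k : ℕ, Set.Ioi (1 / ((k : ℝ) + 1)) := by
    ext x
    simp only [Set.mem_Ioi, Set.mem_iUnion]
    exact ⟨fun hx => exists_nat_one_div_lt hx, fun ⟨k, hk⟩ => lt_trans (by positivity) hk⟩
  have hmono : Monotone fun k : ℕ => Set.Ioi (1 / ((k : ℝ) + 1)) := fun i j hij =>
    Set.Ioi_subset_Ioi (Nat.one_div_le_one_div hij)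
  conv_lhs => rw [hU]
  rw [setLIntegral_iUnion_of_directed _ hmono.directed_le]
  refine iSup_le fun k => ?_
  set ε : ℝ := 1 / ((k : ℝ) + 1)
  have hε : 0 < ε := by positivity
  -- Beyond $b$ the factor $g$ kills the integrand, whatever the sign of the logarithm there.
  have hzero : ∀ s : Set ℝ, s ⊆ Set.Ici b → MeasurableSet s → ∫⁻ ρ in s,
      ENNReal.ofReal (q ^ (m + 2) * (|g ρ| ^ (m + 2) / (ρ * Real.log (r / ρ)) ^ (m + 2)) *
        ρ ^ (m + 1)) = 0 := by
    intro s hs hsm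
    rw [setLIntegral_congr_fun (g := fun _ => 0) hsm fun ρ hρ => by simp [hgb ρ (hs hρ)]]
    simp
  rcases le_total b ε with h | h
  · rw [hzero (Set.Ioi ε) (fun x hx => h.trans (le_of_lt hx)) measurableSet_Ioi]
    exact zero_le
  · rw [← Set.Ioc_union_Ioi_eq_Ioi h]
    refine (lintegral_union_le _ _ _).trans ?_
    rw [hzero (Set.Ioi b) Set.Ioi_subset_Ici_self measurableSet_Ioi, add_zero]
    refine (hardy_Ioc m hg hε h hb (hgb b le_rfl) hq).trans ?_
    exact lintegral_mono_set fun x hx => hε.trans hx.1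

/-! ### Polar coordinates, the anisotropic radius and test functions -/

/-- Integration in polar coordinates. -/
lemma lintegral_eq_lintegral_toSphere {n : ℕ} [NeZero n] {f : E n → ℝ≥0∞} (hf : Measurable f) :
    ∫⁻ x, f x = ∫⁻ θ : Metric.sphere (0 : E n) 1,
      (∫⁻ ρ in Set.Ioi (0 : ℝ), f (ρ • (θ : E n)) * ENNReal.ofReal (ρ ^ (n - 1)))
        ∂(volume : Measure (E n)).toSphere := by
  have : Nonempty (Fin n) := ⟨0⟩
  have hmp := (volume : Measure (E n)).measurePreserving_homeomorphUnitSphereProd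
  have h1 : ∫⁻ x, f x = ∫⁻ x : ({0}ᶜ : Set (E n)), f x ∂(volume.comap Subtype.val) := by
    rw [lintegral_subtype_comap (measurableSet_singleton (0 : E n)).compl,
      restrict_compl_singleton]
  set G : Metric.sphere (0 : E n) 1 × Set.Ioi (0 : ℝ) → ℝ≥0∞ :=
    fun p => f ((p.2 : ℝ) • (p.1 : E n)) with hG
  have hGm : Measurable G := by
    have h3 : Continuous fun p : Metric.sphere (0 : E n) 1 × Set.Ioi (0 : ℝ) =>
        (p.2 : ℝ) • (p.1 : E n) := by fun_prop
    exact hf.comp h3.measurable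
  have h2 : ∀ x : ({0}ᶜ : Set (E n)), G (homeomorphUnitSphereProd (E n) x) = f x := by
    intro x
    have hx : ‖(x : E n)‖ ≠ 0 := norm_ne_zero_iff.2 x.2
    simp [hG, smul_smul, hx]
  rw [h1, lintegral_congr fun x => (h2 x).symm, hmp.lintegral_comp hGm,
    lintegral_prod _ hGm.aemeasurable]
  refine lintegral_congr fun θ => ?_
  have hdm : Measurable fun r : Set.Ioi (0 : ℝ) =>
      ENNReal.ofReal ((r : ℝ) ^ (Module.finrank ℝ (E n) - 1)) := by fun_prop
  have hGθ : Measurable fun r => G (θ, r) := hGm.comp (measurable_const.prodMk measurable_id)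
  rw [Measure.volumeIoiPow, lintegral_withDensity_eq_lintegral_mul _ hdm hGθ,
    ← lintegral_subtype_comap measurableSet_Ioi]
  refine lintegral_congr fun r => ?_
  simp [hG, mul_comm]

/-- The density `|u|ⁿ / (F∘ log (R_Ω / F∘))ⁿ |∇F∘|`, which dominates `hardyDensity`. -/
noncomputable def logHardyDensity {n : ℕ} (F : E n → ℝ) (Ω : Set (E n)) (u : E n → ℝ)
    (x : E n) : ℝ :=
  |u x| ^ n / (polar F x * Real.log (anisotropicRadius F Ω / polar F x)) ^ n *
    ‖gradient (polar F) x‖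

section Radius

variable {n : ℕ} {F : E n → ℝ} {a : ℝ} {K : ℝ≥0} {Ω : Set (E n)}

/-- The supremum is not attained on an open set: a nonzero point can be pushed outwards along its
ray, and at the origin any nearby point has a larger value. Hence the logarithm in the Hardy weight
is positive on $\Omega$ away from the origin. -/
lemma polar_lt_anisotropicRadius [NeZero n] (hN : IsLipschitzGauge (polar F) a K)
    (hΩo : IsOpen Ω) (hΩb : Bornology.IsBounded Ω) {x : E n} (hx : x ∈ Ω) :
    polar F x < anisotropicRadius F Ω := by
  have hbdd : BddAbove (polar F '' Ω) := by
    obtain ⟨M, hM⟩ := hΩb.exists_norm_le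
    refine ⟨K * M, ?_⟩
    rintro _ ⟨y, hy, rfl⟩
    exact (hN.le_norm y).trans (mul_le_mul_of_nonneg_left (hM y hy) K.2)
  rcases eq_or_ne x 0 with rfl | hx0
  · have : Nonempty (Fin n) := ⟨0⟩
    have : (𝓝[≠] (0 : E n)).NeBot := inferInstance
    obtain ⟨y, hy, hy0⟩ := NeBot.nonempty_of_mem this (inter_mem (mem_nhdsWithin_of_mem_nhds
      (hΩo.mem_nhds hx)) (self_mem_nhdsWithin (a := (0 : E n)) (s := {0}ᶜ)))
    rw [hN.map_zero]
    exact (hN.map_pos hy0).trans_le (le_csSup hbdd ⟨y, hy, rfl⟩)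
  · have hc : Tendsto (fun t : ℝ => t • x) (𝓝[>] 1) (𝓝 x) := by
      have : Tendsto (fun t : ℝ => t • x) (𝓝 1) (𝓝 ((1 : ℝ) • x)) :=
        (continuous_id.smul continuous_const).tendsto 1
      rw [one_smul] at this
      exact this.mono_left nhdsWithin_le_nhds
    obtain ⟨t, ht, ht1⟩ := ((hc.eventually (hΩo.mem_nhds hx)).and self_mem_nhdsWithin).exists
    have ht1 : 1 < t := ht1
    have h1 := hN.homogeneous t x (one_pos.trans ht1)
    have h2 := hN.map_pos hx0
    calc polar F x < t * polar F x := by nlinarith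
      _ = polar F (t • x) := h1.symm
      _ ≤ _ := le_csSup hbdd ⟨_, ht, rfl⟩

end Radius

namespace IsTestFunction

variable {n : ℕ} {Ω : Set (E n)} {φ ψ : E n → ℝ}

lemma contDiff_one (hφ : IsTestFunction Ω φ) : ContDiff ℝ 1 φ :=
  hφ.smooth.of_le (by exact_mod_cast le_top)

lemma eq_zero (hφ : IsTestFunction Ω φ) {x : E n} (hx : x ∉ Ω) : φ x = 0 :=
  image_eq_zero_of_notMem_tsupport fun h => hx (hφ.tsupport_subset h)

lemma gradient_eq_zero (hφ : IsTestFunction Ω φ) {x : E n} (hx : x ∉ Ω) : gradient φ x = 0 := by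
  have : fderiv ℝ φ x = 0 := by
    by_contra h
    exact hx (hφ.tsupport_subset (support_fderiv_subset ℝ h))
  simp [gradient, this]

lemma continuous_gradient (hφ : IsTestFunction Ω φ) : Continuous (gradient φ) :=
  (InnerProductSpace.toDual ℝ (E n)).symm.continuous.comp
    (hφ.contDiff_one.continuous_fderiv one_ne_zero)

lemma gradient_sub (hφ : IsTestFunction Ω φ) (hψ : IsTestFunction Ω ψ) (x : E n) :
    gradient (fun y => φ y - ψ y) x = gradient φ x - gradient ψ x := by
  have h := fderiv_fun_sub (hφ.contDiff_one.differentiable (by norm_num) x)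
    (hψ.contDiff_one.differentiable (by norm_num) x)
  simp [gradient, h]

lemma sub (hφ : IsTestFunction Ω φ) (hψ : IsTestFunction Ω ψ) :
    IsTestFunction Ω fun x => φ x - ψ x where
  smooth := hφ.smooth.sub hψ.smooth
  hasCompactSupport := hφ.hasCompactSupport.sub hψ.hasCompactSupport
  tsupport_subset := (tsupport_sub φ ψ).trans
    (Set.union_subset hφ.tsupport_subset hψ.tsupport_subset)

end IsTestFunction

/-! ### Hardy's inequality on $W_0^{1,n}(\Omega)$ -/

section Hardy

variable {n : ℕ} {F : E n → ℝ} {a : ℝ} {K : ℝ≥0} {Ω : Set (E n)}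

lemma measurable_radialEnergyDensity (hN : IsLipschitzGauge (polar F) a K) {w : E n → E n}
    (hw : Measurable w) : Measurable (radialEnergyDensity F w) := by
  have h1 : Measurable fun x : E n => (polar F x)⁻¹ • x := hN.measurable.inv.smul measurable_id
  exact ((hw.inner h1).abs.pow_const n).mul IsLipschitzGauge.measurable_norm_gradient

lemma measurable_logHardyDensity (hN : IsLipschitzGauge (polar F) a K) {u : E n → ℝ}
    (hu : Measurable u) : Measurable (logHardyDensity F Ω u) := by
  have h1 := hN.measurable
  exact ((hu.abs.pow_const n).div ((h1.mul ((measurable_const.div h1).log)).pow_const n)).mul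
    IsLipschitzGauge.measurable_norm_gradient

/-- Hardy's inequality with the weight `(F∘ log (R_Ω / F∘))⁻ⁿ` for test functions. -/
lemma hardy_testFunction (hn : 2 ≤ n) (hN : IsLipschitzGauge (polar F) a K)
    (hlt : ∀ x ∈ Ω, polar F x < anisotropicRadius F Ω) (hΩ : (0 : E n) ∈ Ω) {φ : E n → ℝ}
    (hφ : IsTestFunction Ω φ) :
    ∫⁻ x, ENNReal.ofReal ((((n : ℝ) - 1) / n) ^ n * logHardyDensity F Ω φ x) ≤
      ∫⁻ x, ENNReal.ofReal (radialEnergyDensity F (gradient φ) x) := by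
  obtain ⟨m, rfl⟩ := Nat.exists_eq_add_of_le' hn
  set q : ℝ := (((m + 2 : ℕ) : ℝ) - 1) / (m + 2 : ℕ) with hqdef
  have hq : q = (m + 1) / (m + 2) := by
    rw [hqdef]; push_cast; ring
  set R := anisotropicRadius F Ω with hR
  have hR0 : 0 < R := hN.map_zero ▸ hlt 0 hΩ
  -- Compactness of the support gives a margin below $R$, so the one-dimensional inequality is used
  -- only where the logarithm stays away from $0$.
  obtain ⟨M, hMR, hM⟩ : ∃ M < R, ∀ x, M ≤ polar F x → φ x = 0 := by
    rcases (tsupport φ).eq_empty_or_nonempty with he | hne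
    · refine ⟨0, hR0, fun x _ => image_eq_zero_of_notMem_tsupport ?_⟩
      simp [he]
    · obtain ⟨y, hy, hmax⟩ := hφ.hasCompactSupport.isCompact.exists_isMaxOn hne
        hN.lipschitz.continuous.continuousOn
      have hyR := hlt y (hφ.tsupport_subset hy)
      refine ⟨(polar F y + R) / 2, by linarith, fun x hx =>
        image_eq_zero_of_notMem_tsupport fun h => ?_⟩
      have h2 : polar F x ≤ polar F y := hmax h
      linarith
  have hm1 : Measurable fun x => ENNReal.ofReal (q ^ (m + 2) * logHardyDensity F Ω φ x) :=
    ((measurable_logHardyDensity hN hφ.smooth.continuous.measurable).const_mul _).ennreal_ofReal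
  have hm2 : Measurable fun x => ENNReal.ofReal (radialEnergyDensity F (gradient φ) x) :=
    (measurable_radialEnergyDensity hN hφ.continuous_gradient.measurable).ennreal_ofReal
  rw [lintegral_eq_lintegral_toSphere hm1, lintegral_eq_lintegral_toSphere hm2]
  refine lintegral_mono fun θ => ?_
  have hθ0 : (θ : E (m + 2)) ≠ 0 := by
    intro h
    have := mem_sphere_zero_iff_norm.1 θ.2
    simp [h] at this
  set p : ℝ := polar F (θ : E (m + 2)) with hp
  have hp0 : 0 < p := hN.map_pos hθ0
  -- On the ray $x=\rho\theta$ one has $F_\circ(x)=\rho p$ with $|\nabla F_\circ|$ constant. Both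
  -- integrands then carry this same factor, and $R/(\rho p)$ becomes $r/\rho$ with $r=R/p$.
  set c : ℝ := ‖gradient (polar F) (θ : E (m + 2))‖ / p ^ (m + 2) with hc
  have hc0 : 0 ≤ c := by positivity
  set g : ℝ → ℝ := fun ρ => φ (ρ • (θ : E (m + 2))) with hg
  have hgd : ContDiff ℝ 1 g := hφ.contDiff_one.comp (contDiff_id.smul contDiff_const)
  have hgderiv : ∀ ρ, deriv g ρ = inner ℝ (gradient φ (ρ • (θ : E (m + 2)))) (θ : E (m + 2)) := by
    intro ρ
    have h1 : HasFDerivAt φ (fderiv ℝ φ (ρ • (θ : E (m + 2)))) (ρ • (θ : E (m + 2))) :=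
      (hφ.contDiff_one.differentiable (by norm_num) _).hasFDerivAt
    have h2 : HasDerivAt (fun s : ℝ => s • (θ : E (m + 2))) (θ : E (m + 2)) ρ := by
      simpa using (hasDerivAt_id ρ).smul_const (θ : E (m + 2))
    have h3 : HasDerivAt g (fderiv ℝ φ (ρ • (θ : E (m + 2))) (θ : E (m + 2))) ρ :=
      h1.comp_hasDerivAt ρ h2
    rw [h3.deriv, gradient, InnerProductSpace.toDual_symm_apply]
  have hray := hardy_Ioi m hgd (r := R / p) (b := M / p) (q := q)
    ((div_lt_div_iff_of_pos_right hp0).2 hMR) (fun ρ hρ => by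
      rw [div_le_iff₀ hp0] at hρ
      -- The gauge is homogeneous only under positive factors; for $\rho\le0$ the hypothesis forces
      -- $M\le0$, and then $\varphi$ vanishes identically.
      rcases le_or_gt ρ 0 with h | h
      · have hM0 : M ≤ 0 := hρ.trans (mul_nonpos_of_nonpos_of_nonneg h hp0.le)
        exact hM _ (hM0.trans (hN.nonneg _))
      · exact hM _ (by rwa [hN.homogeneous _ _ h])) hq
  have e1 : ∀ ρ ∈ Set.Ioi (0 : ℝ),
      ENNReal.ofReal (q ^ (m + 2) * logHardyDensity F Ω φ (ρ • (θ : E (m + 2)))) *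
        ENNReal.ofReal (ρ ^ (m + 2 - 1)) = ENNReal.ofReal c * ENNReal.ofReal
        (q ^ (m + 2) * (|g ρ| ^ (m + 2) / (ρ * Real.log (R / p / ρ)) ^ (m + 2)) *
        ρ ^ (m + 1)) := by
    intro ρ hρ
    have hρ : 0 < ρ := hρ
    rw [← ENNReal.ofReal_mul' (by positivity), ← ENNReal.ofReal_mul hc0, logHardyDensity,
      hN.homogeneous _ _ hρ, hN.norm_gradient_smul hρ, ← hp, ← hR, hc, div_div, mul_comm p ρ]
    congr 1
    rw [Nat.add_sub_assoc (by norm_num)]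
    simp only [hg, mul_pow, div_eq_mul_inv, mul_inv, Nat.add_one_sub_one]
    ring
  have e2 : ∀ ρ ∈ Set.Ioi (0 : ℝ),
      ENNReal.ofReal (radialEnergyDensity F (gradient φ) (ρ • (θ : E (m + 2)))) *
        ENNReal.ofReal (ρ ^ (m + 2 - 1)) = ENNReal.ofReal c * ENNReal.ofReal
        (|deriv g ρ| ^ (m + 2) * ρ ^ (m + 1)) := by
    intro ρ hρ
    have hρ : 0 < ρ := hρ
    rw [← ENNReal.ofReal_mul' (by positivity), ← ENNReal.ofReal_mul hc0, radialEnergyDensity,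
      hN.homogeneous _ _ hρ, hN.norm_gradient_smul hρ, ← hp, hc, hgderiv, smul_smul]
    congr 1
    have : (ρ * p)⁻¹ * ρ = p⁻¹ := by field_simp
    rw [this, inner_smul_right, abs_mul, abs_of_pos (inv_pos.2 hp0), mul_pow,
      Nat.add_sub_assoc (by norm_num)]
    simp only [div_eq_mul_inv, Nat.add_one_sub_one, inv_pow]
    ring
  rw [setLIntegral_congr_fun measurableSet_Ioi e1, setLIntegral_congr_fun measurableSet_Ioi e2,
    lintegral_const_mul' _ _ ENNReal.ofReal_ne_top, lintegral_const_mul' _ _ ENNReal.ofReal_ne_top]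
  gcongr

lemma radialEnergyDensity_nonneg (w : E n → E n) (x : E n) : 0 ≤ radialEnergyDensity F w x :=
  mul_nonneg (pow_nonneg (abs_nonneg _) _) (norm_nonneg _)

/-- The `Lⁿ` function whose `n`-th power is the radial energy density. -/
noncomputable def radialEnergyRoot (F : E n → ℝ) (w : E n → E n) (x : E n) : ℝ :=
  inner ℝ (w x) ((polar F x)⁻¹ • x) * ‖gradient (polar F) x‖ ^ (1 / (n : ℝ))

lemma norm_radialEnergyRoot_pow [NeZero n] (w : E n → E n) (x : E n) :
    ‖radialEnergyRoot F w x‖ ^ n = radialEnergyDensity F w x := by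
  rw [radialEnergyRoot, radialEnergyDensity, Real.norm_eq_abs, abs_mul, mul_pow]
  congr 1
  rw [abs_of_nonneg (by positivity), ← Real.rpow_natCast, ← Real.rpow_mul (norm_nonneg _),
    one_div_mul_cancel (Nat.cast_ne_zero.2 (NeZero.ne n)), Real.rpow_one]

/-- The energy is the $n$-th power of the $L^n$ norm of a function linear in $w$, so Minkowski's
inequality controls the energies of an approximating sequence. -/
lemma lintegral_radialEnergyDensity [NeZero n] (w : E n → E n) (μ : Measure (E n)) :
    ∫⁻ x, ENNReal.ofReal (radialEnergyDensity F w x) ∂μ =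
      eLpNorm (radialEnergyRoot F w) n μ ^ (n : ℝ) := by
  have hn0 : (n : ℝ) ≠ 0 := Nat.cast_ne_zero.2 (NeZero.ne n)
  rw [eLpNorm_eq_lintegral_rpow_enorm_toReal (by simpa using NeZero.ne n) (by simp),
    ENNReal.toReal_natCast, ← ENNReal.rpow_mul, one_div_mul_cancel hn0, ENNReal.rpow_one]
  refine lintegral_congr fun x => ?_
  rw [ENNReal.rpow_natCast, ← ofReal_norm, ← ENNReal.ofReal_pow (norm_nonneg _),
    norm_radialEnergyRoot_pow]

lemma norm_radialEnergyRoot_le (hN : IsLipschitzGauge (polar F) a K) (w : E n → E n) (x : E n) :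
    ‖radialEnergyRoot F w x‖ ≤ (a⁻¹ * (K : ℝ) ^ (1 / (n : ℝ))) * ‖w x‖ := by
  have h1 : ‖(polar F x)⁻¹ • x‖ ≤ a⁻¹ := by
    rcases eq_or_ne x 0 with rfl | hx
    · simpa using hN.pos.le
    rw [norm_smul, norm_inv, Real.norm_of_nonneg (hN.nonneg x), inv_mul_le_iff₀ (hN.map_pos hx),
      ← div_eq_mul_inv, le_div_iff₀ hN.pos, mul_comm]
    exact hN.lower x
  have h2 : |inner ℝ (w x) ((polar F x)⁻¹ • x)| ≤ ‖w x‖ * a⁻¹ :=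
    (abs_real_inner_le_norm _ _).trans (by gcongr)
  have h3 := hN.norm_gradient_le x
  have := hN.pos
  rw [radialEnergyRoot, Real.norm_eq_abs, abs_mul, abs_of_nonneg (a := _ ^ (1 / (n : ℝ)))
    (by positivity)]
  calc _ ≤ ‖w x‖ * a⁻¹ * (K : ℝ) ^ (1 / (n : ℝ)) := by gcongr
    _ = _ := by ring

lemma aestronglyMeasurable_radialEnergyRoot (hN : IsLipschitzGauge (polar F) a K)
    {w : E n → E n} {μ : Measure (E n)} (hw : AEStronglyMeasurable w μ) :
    AEStronglyMeasurable (radialEnergyRoot F w) μ := by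
  have h1 : Measurable fun x : E n => (polar F x)⁻¹ • x := hN.measurable.inv.smul measurable_id
  exact (hw.inner h1.aestronglyMeasurable).mul
    (IsLipschitzGauge.measurable_norm_gradient.pow_const _).aestronglyMeasurable

lemma memLp_radialEnergyRoot (hN : IsLipschitzGauge (polar F) a K)
    {w : E n → E n} {μ : Measure (E n)} (hw : MemLp w n μ) :
    MemLp (radialEnergyRoot F w) n μ :=
  hw.of_le_mul (aestronglyMeasurable_radialEnergyRoot hN hw.1)
    (Eventually.of_forall (norm_radialEnergyRoot_le hN w))

lemma integrable_radialEnergyDensity [NeZero n] (hN : IsLipschitzGauge (polar F) a K)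
    {w : E n → E n} {μ : Measure (E n)} (hw : MemLp w n μ) :
    Integrable (radialEnergyDensity F w) μ := by
  have h := (memLp_radialEnergyRoot hN hw).integrable_norm_pow (NeZero.ne n)
  simpa only [norm_radialEnergyRoot_pow] using h

/-- A sequence of test functions converging a.e. to `u`, with gradients converging in `Lⁿ`. -/
lemma MemSobolevZero.exists_ae_tendsto [NeZero n] {u : E n → ℝ} {Du : E n → E n}
    (hu : MemSobolevZero Ω (n : ℝ≥0∞) u Du) :
    ∃ φ : ℕ → E n → ℝ, (∀ k, IsTestFunction Ω (φ k)) ∧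
      (∀ᵐ x ∂(volume.restrict Ω), Tendsto (fun k => φ k x) atTop (𝓝 (u x))) ∧
      Tendsto (fun k => eLpNorm (fun x => gradient (φ k) x - Du x) n (volume.restrict Ω))
        atTop (𝓝 0) := by
  obtain ⟨φ, hφ, h1, h2⟩ := hu.approx
  have hmeas : TendstoInMeasure (volume.restrict Ω) φ atTop u :=
    tendstoInMeasure_of_tendsto_eLpNorm (by simpa using NeZero.ne n)
      (fun k => (hφ k).smooth.continuous.aestronglyMeasurable) hu.memLp.1 h1
  obtain ⟨ns, hns, hae⟩ := hmeas.exists_seq_tendsto_ae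
  exact ⟨fun k => φ (ns k), fun k => hφ _, hae, h2.comp hns.tendsto_atTop⟩

/-- Hardy's inequality with the weight `(F∘ log (R_Ω / F∘))⁻ⁿ` in `W₀^{1,n}(Ω)`. -/
lemma hardy_sobolev (hn : 2 ≤ n) (hN : IsLipschitzGauge (polar F) a K)
    (hlt : ∀ x ∈ Ω, polar F x < anisotropicRadius F Ω) (hΩ : (0 : E n) ∈ Ω) {u : E n → ℝ}
    {Du : E n → E n} (hu : MemSobolevZero Ω (n : ℝ≥0∞) u Du) :
    ∫⁻ x in Ω, ENNReal.ofReal ((((n : ℝ) - 1) / n) ^ n * logHardyDensity F Ω u x) ≤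
      ∫⁻ x in Ω, ENNReal.ofReal (radialEnergyDensity F Du x) := by
  have : NeZero n := ⟨by omega⟩
  have : Fact (1 ≤ (n : ℝ≥0∞)) := ⟨by exact_mod_cast (by omega : 1 ≤ n)⟩
  obtain ⟨φ, hφ, hae, hgrad⟩ := hu.exists_ae_tendsto
  set C : ℝ := a⁻¹ * (K : ℝ) ^ (1 / (n : ℝ)) with hC
  -- Minkowski upper bound for the energy of $\varphi_k$, which tends to the energy of $u$.
  set e : ℕ → ℝ≥0∞ := fun k => (eLpNorm (radialEnergyRoot F Du) n (volume.restrict Ω) +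
    ENNReal.ofReal C * eLpNorm (fun x => gradient (φ k) x - Du x) n (volume.restrict Ω))
      ^ (n : ℝ) with he
  have hlim : Tendsto e atTop
      (𝓝 (∫⁻ x in Ω, ENNReal.ofReal (radialEnergyDensity F Du x))) := by
    rw [lintegral_radialEnergyDensity]
    refine ((ENNReal.continuous_rpow_const (y := (n : ℝ))).tendsto _).comp ?_
    have h1 := ENNReal.Tendsto.const_mul (a := ENNReal.ofReal C) hgrad
      (Or.inr ENNReal.ofReal_ne_top)
    have h2 := (tendsto_const_nhds
      (x := eLpNorm (radialEnergyRoot F Du) n (volume.restrict Ω))).add h1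
    simpa using h2
  have hbound : ∀ k, ∫⁻ x in Ω, ENNReal.ofReal
      ((((n : ℝ) - 1) / n) ^ n * logHardyDensity F Ω (φ k) x) ≤ e k := by
    intro k
    have hsub : radialEnergyRoot F (gradient (φ k)) = radialEnergyRoot F Du +
        radialEnergyRoot F (fun x => gradient (φ k) x - Du x) := by
      funext x
      simp only [radialEnergyRoot, Pi.add_apply, inner_sub_left]
      ring
    have hDm := hu.memLp_grad.1
    have hgm : AEStronglyMeasurable (fun x => gradient (φ k) x - Du x) (volume.restrict Ω) :=
      (hφ k).continuous_gradient.aestronglyMeasurable.sub hDm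
    calc _ ≤ ∫⁻ x, ENNReal.ofReal ((((n : ℝ) - 1) / n) ^ n * logHardyDensity F Ω (φ k) x) :=
          setLIntegral_le_lintegral _ _
      _ ≤ ∫⁻ x, ENNReal.ofReal (radialEnergyDensity F (gradient (φ k)) x) :=
          hardy_testFunction hn hN hlt hΩ (hφ k)
      _ = ∫⁻ x in Ω, ENNReal.ofReal (radialEnergyDensity F (gradient (φ k)) x) := by
          refine (setLIntegral_eq_of_support_subset fun x hx => ?_).symm
          by_contra hxΩ
          exact hx (by simp [radialEnergyDensity, (hφ k).gradient_eq_zero hxΩ, NeZero.ne n])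
      _ ≤ e k := by
          rw [lintegral_radialEnergyDensity, hsub, he]
          refine ENNReal.rpow_le_rpow ?_ (Nat.cast_nonneg n)
          refine (eLpNorm_add_le (aestronglyMeasurable_radialEnergyRoot hN hDm)
            (aestronglyMeasurable_radialEnergyRoot hN hgm) Fact.out).trans ?_
          gcongr
          exact eLpNorm_le_mul_eLpNorm_of_ae_le_mul
            (Eventually.of_forall (norm_radialEnergyRoot_le hN _)) _
  -- Fatou's lemma handles the Hardy side, where only a.e. convergence is available.
  calc _ ≤ ∫⁻ x in Ω, liminf (fun k => ENNReal.ofReal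
        ((((n : ℝ) - 1) / n) ^ n * logHardyDensity F Ω (φ k) x)) atTop := by
        refine lintegral_mono_ae ?_
        filter_upwards [hae] with x hx
        refine le_of_eq (Tendsto.liminf_eq ?_).symm
        refine ENNReal.tendsto_ofReal (Tendsto.const_mul _ ?_)
        exact ((hx.abs.pow n).div_const _).mul_const _
    _ ≤ liminf (fun k => ∫⁻ x in Ω, ENNReal.ofReal
        ((((n : ℝ) - 1) / n) ^ n * logHardyDensity F Ω (φ k) x)) atTop :=
        lintegral_liminf_le fun k => ((measurable_logHardyDensity hN
          (hφ k).smooth.continuous.measurable).const_mul _).ennreal_ofReal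
    _ ≤ liminf e atTop := liminf_le_liminf (Eventually.of_forall hbound)
    _ = _ := hlim.liminf_eq

end Hardy

/-! ### The weights $X_1$, $X_2$ and positivity of the Hardy difference -/

lemma X₁_eq_zero_or {t : ℝ} (ht0 : 0 ≤ t) : X₁ t = 0 ∨ (0 < t ∧ X₁ t = (1 - Real.log t)⁻¹) := by
  rcases ht0.eq_or_lt with rfl | h
  · left; simp [X₁]
  · right; exact ⟨h, by simp [X₁, h.ne']⟩

lemma X₁_mem_Icc {t : ℝ} (ht0 : 0 ≤ t) (ht1 : t ≤ 1) : X₁ t ∈ Set.Icc 0 1 := by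
  rcases X₁_eq_zero_or ht0 with h | ⟨h0, h⟩
  · simp [h]
  · have := Real.log_nonpos ht0 ht1
    rw [h]
    exact ⟨by rw [inv_nonneg]; linarith, inv_le_one_of_one_le₀ (by linarith)⟩

lemma X₂_mem_Icc {t : ℝ} (ht0 : 0 ≤ t) (ht1 : t ≤ 1) : X₂ t ∈ Set.Icc 0 1 :=
  X₁_mem_Icc (X₁_mem_Icc ht0 ht1).1 (X₁_mem_Icc ht0 ht1).2

lemma measurable_X₁ : Measurable X₁ :=
  Measurable.ite (measurableSet_singleton 0) measurable_const
    (measurable_const.sub Real.measurable_log).inv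

lemma measurable_X₂ : Measurable X₂ := measurable_X₁.comp measurable_X₁

section Hardy

variable {n : ℕ} {F : E n → ℝ} {a : ℝ} {K : ℝ≥0} {Ω : Set (E n)}

lemma hardyDensity_nonneg {u : E n → ℝ} {x : E n} (hN : IsLipschitzGauge (polar F) a K)
    (hx : polar F x < anisotropicRadius F Ω) : 0 ≤ hardyDensity F Ω u x := by
  have h0 := hN.nonneg x
  have h1 := (X₁_mem_Icc (div_nonneg h0 (h0.trans hx.le))
    ((div_le_one (h0.trans_lt hx)).2 hx.le)).1
  unfold hardyDensity
  positivity

/-- Off the origin `hardyDensity` has the weight `(F∘ (1 + log (R_Ω / F∘)))⁻ⁿ`. -/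
lemma hardyDensity_eq {u : E n → ℝ} {x : E n} (hN : IsLipschitzGauge (polar F) a K)
    (hx0 : x ≠ 0) (hx : polar F x < anisotropicRadius F Ω) :
    hardyDensity F Ω u x =
      |u x| ^ n / (polar F x * (1 + Real.log (anisotropicRadius F Ω / polar F x))) ^ n *
        ‖gradient (polar F) x‖ := by
  have h0 := hN.map_pos hx0
  have hR := h0.trans hx
  rw [hardyDensity, X₁, if_neg (div_pos h0 hR).ne', Real.log_div h0.ne' hR.ne',
    Real.log_div hR.ne' h0.ne', mul_pow, inv_pow, ← sub_add, sub_add_eq_add_sub,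
    add_sub_assoc, div_mul_eq_div_div]
  ring

lemma hardyDensity_le {u : E n → ℝ} {x : E n} (hN : IsLipschitzGauge (polar F) a K)
    (hx0 : x ≠ 0) (hx : polar F x < anisotropicRadius F Ω) :
    hardyDensity F Ω u x ≤ logHardyDensity F Ω u x := by
  have h0 := hN.map_pos hx0
  have hl := Real.log_pos ((one_lt_div h0).2 hx)
  rw [hardyDensity_eq hN hx0 hx, logHardyDensity]
  gcongr
  linarith

lemma hardyDensity_lt [NeZero n] {u : E n → ℝ} {x : E n} (hN : IsLipschitzGauge (polar F) a K)
    (hx0 : x ≠ 0) (hx : polar F x < anisotropicRadius F Ω)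
    (hg : 0 < ‖gradient (polar F) x‖) (hux : u x ≠ 0) :
    hardyDensity F Ω u x < logHardyDensity F Ω u x := by
  have h0 := hN.map_pos hx0
  have hl := Real.log_pos ((one_lt_div h0).2 hx)
  have hu : 0 < |u x| ^ n := pow_pos (abs_pos.2 hux) n
  rw [hardyDensity_eq hN hx0 hx, logHardyDensity]
  refine mul_lt_mul_of_pos_right (div_lt_div_of_pos_left hu (by positivity) ?_) hg
  exact pow_lt_pow_left₀ (by nlinarith) (by positivity) (NeZero.ne n)

lemma aestronglyMeasurable_hardyDensity (hN : IsLipschitzGauge (polar F) a K) {u : E n → ℝ}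
    {μ : Measure (E n)} (hu : AEStronglyMeasurable u μ) :
    AEStronglyMeasurable (hardyDensity F Ω u) μ := by
  have h1 := hN.measurable
  have h2 : Measurable fun x : E n => (polar F x ^ n)⁻¹ *
      X₁ (polar F x / anisotropicRadius F Ω) ^ n * ‖gradient (polar F) x‖ :=
    ((h1.pow_const n).inv.mul ((measurable_X₁.comp (h1.div_const _)).pow_const n)).mul
      IsLipschitzGauge.measurable_norm_gradient
  refine ((hu.norm.pow n).mul h2.aestronglyMeasurable).congr (Eventually.of_forall fun x => ?_)
  simp only [hardyDensity, Pi.mul_apply, Pi.pow_apply, Real.norm_eq_abs]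
  ring

lemma aestronglyMeasurable_logHardyDensity (hN : IsLipschitzGauge (polar F) a K) {u : E n → ℝ}
    {μ : Measure (E n)} (hu : AEStronglyMeasurable u μ) :
    AEStronglyMeasurable (logHardyDensity F Ω u) μ := by
  have h1 := hN.measurable
  have h2 : Measurable fun x : E n =>
      ((polar F x * Real.log (anisotropicRadius F Ω / polar F x)) ^ n)⁻¹ *
        ‖gradient (polar F) x‖ :=
    ((h1.mul ((measurable_const.div h1).log)).pow_const n).inv.mul
      IsLipschitzGauge.measurable_norm_gradient
  refine ((hu.norm.pow n).mul h2.aestronglyMeasurable).congr (Eventually.of_forall fun x => ?_)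
  simp only [logHardyDensity, Pi.mul_apply, Pi.pow_apply, Real.norm_eq_abs]
  ring

lemma ae_ne_zero (μ : Measure (E n)) [NullSingletonClass μ] : ∀ᵐ x ∂μ, x ≠ 0 := by
  simp [ae_iff]

lemma logHardyDensity_nonneg {u : E n → ℝ} {x : E n} (hN : IsLipschitzGauge (polar F) a K)
    (hx0 : x ≠ 0) (hx : polar F x < anisotropicRadius F Ω) : 0 ≤ logHardyDensity F Ω u x :=
  (hardyDensity_nonneg hN hx).trans (hardyDensity_le hN hx0 hx)

lemma integrableOn_logHardyDensity (hn : 2 ≤ n) (hN : IsLipschitzGauge (polar F) a K)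
    (hΩm : MeasurableSet Ω) (hlt : ∀ x ∈ Ω, polar F x < anisotropicRadius F Ω)
    (hΩ : (0 : E n) ∈ Ω) {u : E n → ℝ}
    {Du : E n → E n} (hu : MemSobolevZero Ω (n : ℝ≥0∞) u Du) :
    IntegrableOn (logHardyDensity F Ω u) Ω ∧
      (((n : ℝ) - 1) / n) ^ n * ∫ x in Ω, logHardyDensity F Ω u x ≤
        ∫ x in Ω, radialEnergyDensity F Du x := by
  have : NeZero n := ⟨by omega⟩
  have : Nonempty (Fin n) := ⟨0⟩
  have hn' : (2 : ℝ) ≤ n := by exact_mod_cast hn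
  have hq : 0 < (((n : ℝ) - 1) / n) ^ n := pow_pos (div_pos (by linarith) (by linarith)) n
  have hE := integrable_radialEnergyDensity (F := F) hN hu.memLp_grad
  have hnn : 0 ≤ᵐ[volume.restrict Ω] fun x =>
      (((n : ℝ) - 1) / n) ^ n * logHardyDensity F Ω u x := by
    filter_upwards [ae_ne_zero (volume.restrict Ω), ae_restrict_mem hΩm] with x hx0 hx
    exact mul_nonneg hq.le (logHardyDensity_nonneg hN hx0 (hlt x hx))
  have hm : AEStronglyMeasurable (fun x => (((n : ℝ) - 1) / n) ^ n * logHardyDensity F Ω u x)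
      (volume.restrict Ω) :=
    (aestronglyMeasurable_logHardyDensity hN hu.memLp.1).const_mul _
  have hle := hardy_sobolev hn hN hlt hΩ hu
  have hEnn : 0 ≤ᵐ[volume.restrict Ω] radialEnergyDensity F Du :=
    Eventually.of_forall (radialEnergyDensity_nonneg Du)
  have hfin : ∫⁻ x in Ω, ENNReal.ofReal (radialEnergyDensity F Du x) < ∞ :=
    (hasFiniteIntegral_iff_ofReal hEnn).1 hE.2
  have hI : Integrable (fun x => (((n : ℝ) - 1) / n) ^ n * logHardyDensity F Ω u x)
      (volume.restrict Ω) :=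
    ⟨hm, (hasFiniteIntegral_iff_ofReal hnn).2 (hle.trans_lt hfin)⟩
  refine ⟨(integrable_const_mul_iff (IsUnit.mk0 _ hq.ne') _).1 hI, ?_⟩
  rw [← integral_const_mul, integral_eq_lintegral_of_nonneg_ae hnn hm,
    integral_eq_lintegral_of_nonneg_ae hEnn hE.1]
  exact ENNReal.toReal_mono hfin.ne hle

lemma integrableOn_hardyDensity (hn : 2 ≤ n) (hN : IsLipschitzGauge (polar F) a K)
    (hΩm : MeasurableSet Ω) (hlt : ∀ x ∈ Ω, polar F x < anisotropicRadius F Ω)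
    (hΩ : (0 : E n) ∈ Ω) {u : E n → ℝ}
    {Du : E n → E n} (hu : MemSobolevZero Ω (n : ℝ≥0∞) u Du) :
    IntegrableOn (hardyDensity F Ω u) Ω := by
  have : NeZero n := ⟨by omega⟩
  have : Nonempty (Fin n) := ⟨0⟩
  refine (integrableOn_logHardyDensity hn hN hΩm hlt hΩ hu).1.mono'
    (aestronglyMeasurable_hardyDensity hN hu.memLp.1) ?_
  filter_upwards [ae_ne_zero (volume.restrict Ω), ae_restrict_mem hΩm] with x hx0 hx
  rw [Real.norm_of_nonneg (hardyDensity_nonneg hN (hlt x hx))]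
  exact hardyDensity_le hN hx0 (hlt x hx)

lemma radialHardyDifference_pos (hn : 2 ≤ n) (hN : IsLipschitzGauge (polar F) a K)
    (hΩm : MeasurableSet Ω) (hlt : ∀ x ∈ Ω, polar F x < anisotropicRadius F Ω)
    (hΩ : (0 : E n) ∈ Ω) {u : E n → ℝ}
    {Du : E n → E n} (hu : MemSobolevZero Ω (n : ℝ≥0∞) u Du)
    (hu0 : ¬ ∀ᵐ x ∂(volume.restrict Ω), u x = 0) : 0 < radialHardyDifference F Ω u Du := by
  have : NeZero n := ⟨by omega⟩
  have : Nonempty (Fin n) := ⟨0⟩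
  have hn' : (2 : ℝ) ≤ n := by exact_mod_cast hn
  have hq : 0 < (((n : ℝ) - 1) / n) ^ n := pow_pos (div_pos (by linarith) (by linarith)) n
  obtain ⟨hL, hle⟩ := integrableOn_logHardyDensity hn hN hΩm hlt hΩ hu
  have hH := integrableOn_hardyDensity hn hN hΩm hlt hΩ hu
  have hae : ∀ᵐ x ∂(volume.restrict Ω), x ≠ 0 ∧ polar F x < anisotropicRadius F Ω := by
    filter_upwards [ae_ne_zero (volume.restrict Ω), ae_restrict_mem hΩm] with x hx0 hx
    exact ⟨hx0, hlt x hx⟩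
  have hlt' : ∫ x in Ω, hardyDensity F Ω u x < ∫ x in Ω, logHardyDensity F Ω u x := by
    have hmono : hardyDensity F Ω u ≤ᵐ[volume.restrict Ω] logHardyDensity F Ω u := by
      filter_upwards [hae] with x hx using hardyDensity_le hN hx.1 hx.2
    -- Equal integrals of ordered densities would make them equal a.e.; the two weights differ
    -- strictly a.e., so $u$ would vanish a.e.
    refine (integral_mono_ae hH hL hmono).lt_of_ne fun heq => hu0 ?_
    have h0 := (integral_eq_iff_of_ae_le hH hL hmono).1 heq
    filter_upwards [h0, hae, ae_restrict_of_ae hN.ae_norm_gradient_pos] with x hx hx' hg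
    by_contra hux
    exact (hardyDensity_lt hN hx'.1 hx'.2 hg hux).ne hx
  have := mul_lt_mul_of_pos_left hlt' hq
  rw [radialHardyDifference]
  linarith

end Hardy

/-! ### Smooth truncations -/

/-- Outside $(0,1)$ the function takes its global minimum or maximum, which covers the endpoints
too. -/
lemma deriv_smoothTransition_eq_zero {s : ℝ} (hs : s ∉ Set.Ioo (0 : ℝ) 1) :
    deriv Real.smoothTransition s = 0 := by
  rw [Set.mem_Ioo, not_and_or, not_lt, not_lt] at hs
  rcases hs with hs | hs
  · refine IsLocalMin.deriv_eq_zero (Eventually.of_forall fun x => ?_)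
    rw [Real.smoothTransition.zero_of_nonpos hs]
    exact Real.smoothTransition.nonneg x
  · refine IsLocalMax.deriv_eq_zero (Eventually.of_forall fun x => ?_)
    rw [Real.smoothTransition.one_of_one_le hs]
    exact Real.smoothTransition.le_one x

lemma exists_abs_deriv_smoothTransition_le :
    ∃ L : ℝ, 0 < L ∧ ∀ s, |deriv Real.smoothTransition s| ≤ L := by
  have hc : Continuous (deriv Real.smoothTransition) :=
    (Real.smoothTransition.contDiff (n := 1)).continuous_deriv le_rfl
  obtain ⟨L, hL⟩ := (isCompact_Icc (a := (0 : ℝ)) (b := 1)).exists_bound_of_continuousOn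
    hc.continuousOn
  refine ⟨max L 1, by positivity, fun s => ?_⟩
  by_cases hs : s ∈ Set.Ioo (0 : ℝ) 1
  · exact (hL s (Set.Ioo_subset_Icc_self hs)).trans (le_max_left _ _)
  · rw [deriv_smoothTransition_eq_zero hs, abs_zero]
    positivity

/-- A smooth even function that vanishes on `[-a, a]` and is `1` outside `(-(a + h), a + h)`. -/
noncomputable def smoothTruncation (a h s : ℝ) : ℝ :=
  Real.smoothTransition ((s - a) / h) + Real.smoothTransition ((-s - a) / h)

lemma contDiff_smoothTruncation (a h : ℝ) : ContDiff ℝ 1 (smoothTruncation a h) := by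
  have h1 : ContDiff ℝ 1 Real.smoothTransition := Real.smoothTransition.contDiff
  exact (h1.comp ((contDiff_id.sub contDiff_const).div_const h)).add
    (h1.comp ((contDiff_id.neg.sub contDiff_const).div_const h))

lemma smoothTruncation_zero {a h : ℝ} (ha : 0 ≤ a) (hh : 0 < h) : smoothTruncation a h 0 = 0 := by
  have : (-a) / h ≤ 0 := div_nonpos_of_nonpos_of_nonneg (by linarith) hh.le
  simp [smoothTruncation, Real.smoothTransition.zero_of_nonpos this]

lemma one_le_smoothTruncation {a h s : ℝ} (hh : 0 < h) (hs : a + h ≤ |s|) :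
    1 ≤ smoothTruncation a h s := by
  have h1 := Real.smoothTransition.nonneg ((s - a) / h)
  have h2 := Real.smoothTransition.nonneg ((-s - a) / h)
  rcases le_abs.1 hs with h3 | h3
  · have := Real.smoothTransition.one_of_one_le
      (x := (s - a) / h) ((one_le_div hh).2 (by linarith))
    rw [smoothTruncation]
    linarith
  · have := Real.smoothTransition.one_of_one_le
      (x := (-s - a) / h) ((one_le_div hh).2 (by linarith))
    rw [smoothTruncation]
    linarith

lemma deriv_smoothTruncation (a h s : ℝ) : deriv (smoothTruncation a h) s =
    deriv Real.smoothTransition ((s - a) / h) * (1 / h) +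
      deriv Real.smoothTransition ((-s - a) / h) * (-1 / h) := by
  have hd : ∀ x, HasDerivAt Real.smoothTransition (deriv Real.smoothTransition x) x := fun x =>
    ((Real.smoothTransition.contDiff (n := 1)).differentiable (by norm_num) x).hasDerivAt
  have h1 : HasDerivAt (fun s : ℝ => (s - a) / h) (1 / h) s :=
    ((hasDerivAt_id s).sub_const a).div_const h
  have h2 : HasDerivAt (fun s : ℝ => (-s - a) / h) (-1 / h) s :=
    ((hasDerivAt_id s).neg.sub_const a).div_const h
  exact (((hd _).comp s h1).add ((hd _).comp s h2)).deriv

lemma deriv_smoothTruncation_eq_zero {a h s : ℝ} (hh : 0 < h)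
    (hs : ¬ (a < |s| ∧ |s| < a + h)) (ha : 0 ≤ a) : deriv (smoothTruncation a h) s = 0 := by
  rw [deriv_smoothTruncation, deriv_smoothTransition_eq_zero, deriv_smoothTransition_eq_zero]
  · simp
  · rintro ⟨h1, h2⟩
    rw [div_pos_iff_of_pos_right hh] at h1
    rw [div_lt_one hh] at h2
    apply hs
    rw [abs_of_nonpos (by linarith)]
    constructor <;> linarith
  · rintro ⟨h1, h2⟩
    rw [div_pos_iff_of_pos_right hh] at h1
    rw [div_lt_one hh] at h2
    apply hs
    rw [abs_of_nonneg (by linarith)]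
    constructor <;> linarith

lemma abs_deriv_smoothTruncation_le {L a h : ℝ} (hh : 0 < h)
    (hL : ∀ s, |deriv Real.smoothTransition s| ≤ L) (s : ℝ) :
    |deriv (smoothTruncation a h) s| ≤ 2 * L / h := by
  rw [deriv_smoothTruncation]
  refine (abs_add_le _ _).trans ?_
  rw [abs_mul, abs_mul, abs_div, abs_div, abs_neg, abs_one, abs_of_pos hh]
  have h1 := mul_le_mul_of_nonneg_right (hL ((s - a) / h)) (one_div_pos.2 hh).le
  have h2 := mul_le_mul_of_nonneg_right (hL ((-s - a) / h)) (one_div_pos.2 hh).le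
  calc _ ≤ L * (1 / h) + L * (1 / h) := add_le_add h1 h2
    _ = 2 * L / h := by ring

/-! ### Decay of superlevel sets and Trudinger's inequality -/

section Trudinger

variable {n : ℕ}

lemma holderConjugate (hn : 2 ≤ n) : (n : ℝ).HolderConjugate ((n : ℝ) / ((n : ℝ) - 1)) :=
  Real.HolderConjugate.conjExponent (by exact_mod_cast hn)

/-- The `L¹` Sobolev inequality for smooth truncations. -/
lemma exists_measure_superlevel_le (hn : 2 ≤ n) : ∃ Λ : ℝ, 0 < Λ ∧ ∀ (φ : E n → ℝ),
    ContDiff ℝ 1 φ → HasCompactSupport φ → ∀ a h : ℝ, 0 ≤ a → 0 < h →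
    volume {x | a + h ≤ |φ x|} ^ (((n : ℝ) - 1) / n) ≤ ENNReal.ofReal (Λ / h) *
      ∫⁻ x in {x | a < |φ x| ∧ |φ x| < a + h}, ‖gradient φ x‖ₑ := by
  obtain ⟨L, hL0, hL⟩ := exists_abs_deriv_smoothTransition_le
  have hpq := holderConjugate hn
  set p : ℝ≥0 := Real.toNNReal ((n : ℝ) / ((n : ℝ) - 1)) with hp
  have hpc : (p : ℝ) = (n : ℝ) / ((n : ℝ) - 1) := Real.coe_toNNReal _ hpq.symm.nonneg
  have hpq' : NNReal.HolderConjugate (Module.finrank ℝ (E n)) p := by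
    rw [← NNReal.holderConjugate_coe_iff]
    rw [hpc]
    simpa using hpq
  have hp0 : (p : ℝ) ≠ 0 := hpc ▸ hpq.symm.ne_zero
  set C : ℝ≥0 := eLpNormLESNormFDerivOneConst (volume : Measure (E n)) p with hC
  -- $2L/h$ bounds the slope of the truncation; the $+1$ keeps the constant positive.
  refine ⟨(C + 1) * (2 * L), by positivity, fun φ hφ hφc a h ha hh => ?_⟩
  set v : E n → ℝ := fun x => smoothTruncation a h (φ x) with hv
  have hvd : ContDiff ℝ 1 v := (contDiff_smoothTruncation a h).comp hφ
  have hvc : HasCompactSupport v := hφc.comp_left (smoothTruncation_zero ha hh)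
  have hGNS := eLpNorm_le_eLpNorm_fderiv_one (volume : Measure (E n)) hvd hvc hpq'
  have hfd : ∀ x, fderiv ℝ v x = deriv (smoothTruncation a h) (φ x) • fderiv ℝ φ x := fun x =>
    (((contDiff_smoothTruncation a h).differentiable (by norm_num) _).hasDerivAt.comp_hasFDerivAt
      x (hφ.differentiable (by norm_num) x).hasFDerivAt).fderiv
  have hAm : MeasurableSet {x | a < |φ x| ∧ |φ x| < a + h} :=
    (measurableSet_lt measurable_const hφ.continuous.measurable.abs).inter
      (measurableSet_lt hφ.continuous.measurable.abs measurable_const)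
  have hupper : eLpNorm (fderiv ℝ v) 1 volume ≤ ENNReal.ofReal (2 * L / h) *
      ∫⁻ x in {x | a < |φ x| ∧ |φ x| < a + h}, ‖gradient φ x‖ₑ := by
    rw [eLpNorm_one_eq_lintegral_enorm, ← lintegral_const_mul' _ _ ENNReal.ofReal_ne_top,
      ← lintegral_indicator hAm]
    refine lintegral_mono fun x => ?_
    rw [hfd, enorm_smul]
    by_cases hx : x ∈ {x | a < |φ x| ∧ |φ x| < a + h}
    · rw [Set.indicator_of_mem hx]
      have h1 : ‖gradient φ x‖ₑ = ‖fderiv ℝ φ x‖ₑ := by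
        rw [← ofReal_norm, ← ofReal_norm, IsLipschitzGauge.norm_gradient_eq]
      rw [h1]
      gcongr
      rw [← ofReal_norm, Real.norm_eq_abs]
      exact ENNReal.ofReal_le_ofReal (abs_deriv_smoothTruncation_le hh hL _)
    · rw [Set.indicator_of_notMem hx, deriv_smoothTruncation_eq_zero hh hx ha]
      simp
  -- Chebyshev's inequality for the truncation, which is at least $1$ on the upper level set.
  have hlower : volume {x | a + h ≤ |φ x|} ^ (((n : ℝ) - 1) / n) ≤ eLpNorm v p volume := by
    have h1 := meas_ge_le_mul_pow_eLpNorm_enorm (volume : Measure (E n)) (p := (p : ℝ≥0∞))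
      (by simpa using hp0) (by simp) hvd.continuous.aestronglyMeasurable (ε := 1) one_ne_zero
      (by simp)
    rw [inv_one, ENNReal.one_rpow, one_mul, ENNReal.coe_toReal] at h1
    have h2 : volume {x | a + h ≤ |φ x|} ≤ eLpNorm v p volume ^ (p : ℝ) := by
      refine (measure_mono fun x hx => ?_).trans h1
      have h3 : 1 ≤ v x := one_le_smoothTruncation hh hx
      simp only [Set.mem_ofPred_eq]
      rw [← ofReal_norm, ← ENNReal.ofReal_one]
      exact ENNReal.ofReal_le_ofReal (h3.trans (le_abs_self _))
    have h4 : ((n : ℝ) - 1) / n = (p : ℝ)⁻¹ := by rw [hpc, inv_div]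
    rw [h4]
    refine (ENNReal.rpow_le_rpow h2 (by positivity)).trans ?_
    rw [← ENNReal.rpow_mul, mul_inv_cancel₀ hp0, ENNReal.rpow_one]
  refine hlower.trans (hGNS.trans ?_)
  have h5 : ENNReal.ofReal ((C + 1) * (2 * L) / h) =
      ENNReal.ofReal (C + 1) * ENNReal.ofReal (2 * L / h) := by
    rw [← ENNReal.ofReal_mul (by positivity)]
    congr 1
    ring
  rw [h5, mul_assoc]
  refine mul_le_mul' ?_ hupper
  rw [← ENNReal.ofReal_coe_nnreal]
  exact ENNReal.ofReal_le_ofReal (by linarith)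

/-- The decay of superlevel sets from one level to the next one. -/
lemma exists_measureReal_superlevel_le (hn : 2 ≤ n) : ∃ Λ : ℝ, 0 < Λ ∧ ∀ (Ω : Set (E n)),
    volume Ω ≠ ∞ → ∀ (φ : E n → ℝ), IsTestFunction Ω φ →
    ∀ a h : ℝ, 0 ≤ a → 0 < h →
    volume.real {x ∈ Ω | a + h ≤ |φ x|} ≤ (Λ / h) ^ ((n : ℝ) / ((n : ℝ) - 1)) *
      (∫ x in {x | a < |φ x| ∧ |φ x| < a + h}, ‖gradient φ x‖ ^ n) ^ (1 / ((n : ℝ) - 1)) *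
      volume.real {x ∈ Ω | a ≤ |φ x|} := by
  obtain ⟨Λ, hΛ, H⟩ := exists_measure_superlevel_le hn
  refine ⟨Λ, hΛ, fun Ω hΩ φ hφ a h ha hh => ?_⟩
  have hn1 : (0 : ℝ) < (n : ℝ) - 1 := by
    have : (2 : ℝ) ≤ n := by exact_mod_cast hn
    linarith
  have hn0 : (0 : ℝ) < n := by linarith
  have hpq := holderConjugate hn
  set p : ℝ := (n : ℝ) / ((n : ℝ) - 1) with hp
  set A : Set (E n) := {x | a < |φ x| ∧ |φ x| < a + h} with hA
  have hgm := hφ.continuous_gradient.measurable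
  have hAΩ : A ⊆ {x ∈ Ω | a ≤ |φ x|} := fun x hx => by
    refine ⟨?_, hx.1.le⟩
    by_contra hxΩ
    have := hx.1
    rw [hφ.eq_zero hxΩ, abs_zero] at this
    linarith
  have hfin : ∀ s : ℝ, volume {x ∈ Ω | s ≤ |φ x|} ≠ ∞ := fun s =>
    ne_top_of_le_ne_top hΩ (measure_mono fun x hx => hx.1)
  have hgint : Integrable (fun x => ‖gradient φ x‖ ^ n) (volume.restrict A) := by
    refine Integrable.restrict (Continuous.integrable_of_hasCompactSupport
      (hφ.continuous_gradient.norm.pow n) ?_)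
    refine HasCompactSupport.intro hφ.hasCompactSupport.isCompact fun x hx => ?_
    have hgs : IsTestFunction (tsupport φ) φ := ⟨hφ.smooth, hφ.hasCompactSupport, subset_rfl⟩
    simp only [Pi.pow_apply, hgs.gradient_eq_zero hx, norm_zero]
    exact zero_pow (by omega)
  have hHolder : ∫⁻ x in A, ‖gradient φ x‖ₑ ≤
      ENNReal.ofReal (∫ x in A, ‖gradient φ x‖ ^ n) ^ (1 / (n : ℝ)) *
        volume {x ∈ Ω | a ≤ |φ x|} ^ (1 / p) := by
    have h1 := ENNReal.lintegral_mul_le_Lp_mul_Lq (volume.restrict A) hpq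
      (f := fun x => ‖gradient φ x‖ₑ) (g := fun _ => 1) hgm.enorm.aemeasurable aemeasurable_const
    simp only [Pi.mul_apply, mul_one, ENNReal.one_rpow, lintegral_const, one_mul,
      Measure.restrict_apply MeasurableSet.univ, Set.univ_inter] at h1
    refine h1.trans (mul_le_mul' (le_of_eq ?_)
      (ENNReal.rpow_le_rpow (measure_mono hAΩ) (one_div_nonneg.2 hpq.symm.nonneg)))
    rw [ofReal_integral_eq_lintegral_ofReal hgint (Eventually.of_forall fun x => by positivity)]
    congr 1
    refine lintegral_congr fun x => ?_
    rw [ENNReal.rpow_natCast, ← ofReal_norm, ENNReal.ofReal_pow (norm_nonneg _)]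
  have hset : {x ∈ Ω | a + h ≤ |φ x|} ⊆ {x | a + h ≤ |φ x|} := fun x hx => hx.2
  have h2 := (ENNReal.rpow_le_rpow (measure_mono hset)
    (div_nonneg hn1.le hn0.le)).trans ((H φ hφ.contDiff_one hφ.hasCompactSupport a h ha hh).trans
      (mul_le_mul_right hHolder _))
  -- Raising to the power $p=n/(n-1)$ makes both superlevel measures enter with exponent $1$, so the
  -- estimate can be iterated.
  have h3 := ENNReal.rpow_le_rpow h2 hpq.symm.nonneg
  have hI0 : 0 ≤ ∫ x in A, ‖gradient φ x‖ ^ n := integral_nonneg fun x => by positivity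
  have e1 : ((n : ℝ) - 1) / n * p = 1 := by rw [hp]; field_simp
  have e2 : 1 / (n : ℝ) * p = 1 / ((n : ℝ) - 1) := by rw [hp]; field_simp
  have e3 : 1 / p * p = 1 := one_div_mul_cancel hpq.symm.ne_zero
  rw [← ENNReal.rpow_mul, e1, ENNReal.rpow_one, ENNReal.mul_rpow_of_nonneg _ _ hpq.symm.nonneg,
    ENNReal.mul_rpow_of_nonneg _ _ hpq.symm.nonneg, ← ENNReal.rpow_mul, ← ENNReal.rpow_mul, e2,
    e3, ENNReal.rpow_one, ENNReal.ofReal_rpow_of_nonneg (by positivity) hpq.symm.nonneg,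
    ENNReal.ofReal_rpow_of_nonneg hI0 (one_div_pos.2 hn1).le, ← mul_assoc] at h3
  have h4 := ENNReal.toReal_mono (ENNReal.mul_ne_top (ENNReal.mul_ne_top ENNReal.ofReal_ne_top
    ENNReal.ofReal_ne_top) (hfin a)) h3
  rwa [ENNReal.toReal_mul, ENNReal.toReal_mul, ENNReal.toReal_ofReal (by positivity),
    ENNReal.toReal_ofReal (by positivity)] at h4

end Trudinger

section Trudinger

variable {n : ℕ}

lemma prod_le_pow_sum_div {k : ℕ} (hk : 0 < k) (z : ℕ → ℝ) (hz : ∀ i, 0 ≤ z i) :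
    ∏ i ∈ Finset.range k, z i ≤ ((∑ i ∈ Finset.range k, z i) / k) ^ k := by
  have h := Real.geom_mean_le_arith_mean (Finset.range k) (fun _ => 1) z (by simp) (by simpa)
    (fun i _ => hz i)
  simp only [Real.rpow_one, Finset.sum_const, Finset.card_range, nsmul_eq_mul, mul_one,
    one_mul] at h
  have h0 : 0 ≤ ∏ i ∈ Finset.range k, z i := Finset.prod_nonneg fun i _ => hz i
  calc ∏ i ∈ Finset.range k, z i = ((∏ i ∈ Finset.range k, z i) ^ ((k : ℝ)⁻¹)) ^ k := by
        rw [Real.rpow_inv_natCast_pow h0 hk.ne']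
    _ ≤ _ := pow_le_pow_left₀ (by positivity) h k

/-- This identity explains the choice of the level $e\Lambda Gk^{(n-1)/n}$: after division into $k$
steps with average energy $G^n/k$, the loss per step no longer depends on $\Lambda$, $G$ or $k$. -/
lemma level_constant_eq (hn : 2 ≤ n) {Λ G k : ℝ} (hΛ : 0 < Λ) (hG : 0 < G) (hk : 0 < k) :
    (Λ / (Real.exp 1 * Λ * G * k ^ (((n : ℝ) - 1) / n) / k)) ^ ((n : ℝ) / ((n : ℝ) - 1)) *
      (G ^ n / k) ^ (1 / ((n : ℝ) - 1)) = Real.exp (-((n : ℝ) / ((n : ℝ) - 1))) := by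
  have hn1 : (0 : ℝ) < (n : ℝ) - 1 := by
    have : (2 : ℝ) ≤ n := by exact_mod_cast hn
    linarith
  have hn0 : (0 : ℝ) < n := by linarith
  have he := Real.exp_pos 1
  have hkp : 0 < k ^ (((n : ℝ) - 1) / n) := Real.rpow_pos_of_pos hk _
  refine Real.log_injOn_pos (Set.mem_Ioi.2 (by positivity)) (Set.mem_Ioi.2 (by positivity)) ?_
  rw [Real.log_mul (by positivity) (by positivity), Real.log_rpow (by positivity),
    Real.log_rpow (by positivity), Real.log_div hΛ.ne' (by positivity),
    Real.log_div (by positivity) hk.ne', Real.log_mul (by positivity) (by positivity),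
    Real.log_mul (by positivity) (by positivity), Real.log_mul (by positivity) (by positivity),
    Real.log_exp, Real.log_exp, Real.log_rpow hk, Real.log_div (by positivity) hk.ne',
    Real.log_pow]
  field_simp
  ring

/-- Exponential decay of the superlevel sets of a test function. -/
lemma exists_measureReal_superlevel_le_exp (hn : 2 ≤ n) : ∃ A : ℝ, 0 < A ∧ ∀ (Ω : Set (E n)),
    volume Ω ≠ ∞ → ∀ (φ : E n → ℝ), IsTestFunction Ω φ → ∀ G : ℝ, 0 < G →
    ∫ x in Ω, ‖gradient φ x‖ ^ n ≤ G ^ n → ∀ k : ℕ,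
    volume.real {x ∈ Ω | A * G * (k : ℝ) ^ (((n : ℝ) - 1) / n) ≤ |φ x|} ≤
      Real.exp (-k) * volume.real Ω := by
  obtain ⟨Λ, hΛ, H⟩ := exists_measureReal_superlevel_le hn
  refine ⟨Real.exp 1 * Λ, by positivity, fun Ω hΩ φ hφ G hG hGφ k => ?_⟩
  have hn2 : (2 : ℝ) ≤ n := by exact_mod_cast hn
  have hn1 : (0 : ℝ) < (n : ℝ) - 1 := by linarith
  rcases Nat.eq_zero_or_pos k with rfl | hk
  · simpa using measureReal_mono (μ := volume) (fun x (hx : x ∈ {x ∈ Ω | _}) => hx.1) hΩ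
  have hk0 : (0 : ℝ) < k := by exact_mod_cast hk
  set t : ℝ := Real.exp 1 * Λ * G * (k : ℝ) ^ (((n : ℝ) - 1) / n) with ht
  have ht0 : 0 < t := by positivity
  -- The level $t$ is reached in exactly $k$ equal steps.
  set h : ℝ := t / k with hh
  have hh0 : 0 < h := by positivity
  set β : ℝ := 1 / ((n : ℝ) - 1) with hβ
  set c : ℝ := (Λ / h) ^ ((n : ℝ) / ((n : ℝ) - 1)) with hc
  have hc0 : 0 < c := by positivity
  set S : ℕ → Set (E n) := fun i => {x | i * h < |φ x| ∧ |φ x| < i * h + h} with hS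
  set e : ℕ → ℝ := fun i => ∫ x in S i, ‖gradient φ x‖ ^ n with he
  have he0 : ∀ i, 0 ≤ e i := fun i => integral_nonneg fun x => by positivity
  set m : ℕ → ℝ := fun i => volume.real {x ∈ Ω | i * h ≤ |φ x|} with hm
  have hstep : ∀ i, m (i + 1) ≤ c * e i ^ β * m i := fun i => by
    have := H Ω hΩ φ hφ (i * h) h (by positivity) hh0
    simp only [hm]
    push_cast
    rwa [add_one_mul]
  have hind : ∀ j, m j ≤ c ^ j * (∏ i ∈ Finset.range j, e i) ^ β * m 0 := by
    intro j
    induction j with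
    | zero => simp
    | succ j ih =>
      have h0 : 0 ≤ ∏ i ∈ Finset.range j, e i := Finset.prod_nonneg fun i _ => he0 i
      refine (hstep j).trans ((mul_le_mul_of_nonneg_left ih
        (mul_nonneg hc0.le (Real.rpow_nonneg (he0 j) _))).trans (le_of_eq ?_))
      rw [Finset.prod_range_succ, Real.mul_rpow h0 (he0 j)]
      ring
  have hgint : IntegrableOn (fun x => ‖gradient φ x‖ ^ n) Ω := by
    refine Integrable.restrict (Continuous.integrable_of_hasCompactSupport
      (hφ.continuous_gradient.norm.pow n) ?_)
    refine HasCompactSupport.intro hφ.hasCompactSupport.isCompact fun x hx => ?_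
    have hgs : IsTestFunction (tsupport φ) φ := ⟨hφ.smooth, hφ.hasCompactSupport, subset_rfl⟩
    simp only [Pi.pow_apply, hgs.gradient_eq_zero hx, norm_zero]
    exact zero_pow (by omega)
  have hSΩ : ∀ i, S i ⊆ Ω := fun i x hx => by
    by_contra hxΩ
    have h1 := hx.1
    rw [hφ.eq_zero hxΩ, abs_zero] at h1
    have : 0 ≤ (i : ℝ) * h := by positivity
    linarith
  have hSm : ∀ i, MeasurableSet (S i) := fun i =>
    (measurableSet_lt measurable_const hφ.smooth.continuous.measurable.abs).inter
      (measurableSet_lt hφ.smooth.continuous.measurable.abs measurable_const)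
  have hdisj : ∀ i j, i < j → Disjoint (S i) (S j) := fun i j hij => by
    refine Set.disjoint_left.2 fun x hx hy => ?_
    have h1 : ((i : ℝ) + 1) * h ≤ j * h :=
      mul_le_mul_of_nonneg_right (by exact_mod_cast hij) hh0.le
    have h2 := hx.2
    have h3 := hy.1
    linarith
  have hsum : ∑ i ∈ Finset.range k, e i ≤ G ^ n := by
    rw [he, ← integral_biUnion_finset _ (fun i _ => hSm i) (fun i _ j _ hij => ?_)
      (fun i _ => hgint.mono_set (hSΩ i))]
    · refine (setIntegral_mono_set hgint (Eventually.of_forall fun x => by positivity) ?_).trans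
        hGφ
      exact (Set.iUnion₂_subset fun i _ => hSΩ i).eventuallyLE
    · rcases lt_or_gt_of_ne hij with h1 | h1
      · exact hdisj i j h1
      · exact (hdisj j i h1).symm
  -- The strips between levels are disjoint, so their energies sum to at most $G^n$; by AM-GM the
  -- product is largest when they are equal.
  have hprod : ∏ i ∈ Finset.range k, e i ≤ (G ^ n / k) ^ k :=
    (prod_le_pow_sum_div hk e he0).trans (pow_le_pow_left₀
      (div_nonneg (Finset.sum_nonneg fun i _ => he0 i) hk0.le) (by gcongr) k)
  have hm0 : m 0 ≤ volume.real Ω :=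
    measureReal_mono (fun x hx => hx.1) hΩ
  have hkh : (k : ℝ) * h = t := by rw [hh]; field_simp
  have hB : c * (G ^ n / k) ^ β = Real.exp (-((n : ℝ) / ((n : ℝ) - 1))) :=
    level_constant_eq hn hΛ hG hk0
  have hprod0 : 0 ≤ ∏ i ∈ Finset.range k, e i := Finset.prod_nonneg fun i _ => he0 i
  calc volume.real {x ∈ Ω | t ≤ |φ x|} = m k := by simp only [hm, hkh]
    _ ≤ c ^ k * (∏ i ∈ Finset.range k, e i) ^ β * m 0 := hind k
    _ ≤ c ^ k * ((G ^ n / k) ^ k) ^ β * volume.real Ω := by gcongr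
    _ = (c * (G ^ n / k) ^ β) ^ k * volume.real Ω := by
        rw [mul_pow, ← Real.rpow_natCast (G ^ n / k) k, ← Real.rpow_natCast ((G ^ n / k) ^ β) k,
          ← Real.rpow_mul (by positivity), ← Real.rpow_mul (by positivity), mul_comm β]
    _ ≤ Real.exp (-k) * volume.real Ω := by
        rw [hB, ← Real.exp_nat_mul]
        gcongr
        have : 1 ≤ (n : ℝ) / ((n : ℝ) - 1) := by
          rw [le_div_iff₀ hn1]; linarith
        nlinarith

/-- Layer-cake summation over integer levels. -/
lemma lintegral_exp_half_le {α : Type*} [MeasurableSpace α] (μ : Measure α) {v : α → ℝ}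
    (hv : Measurable v) (hv0 : ∀ x, 0 ≤ v x) {V : ℝ≥0∞}
    (h : ∀ k : ℕ, μ {x | (k : ℝ) ≤ v x} ≤ ENNReal.ofReal (Real.exp (-k)) * V) :
    ∫⁻ x, ENNReal.ofReal (Real.exp (v x / 2)) ∂μ ≤
      (∑' k : ℕ, ENNReal.ofReal (Real.exp ((1 - k) / 2))) * V := by
  have hmeas : ∀ k : ℕ, MeasurableSet {x | (k : ℝ) ≤ v x} := fun k =>
    measurableSet_le measurable_const hv
  calc ∫⁻ x, ENNReal.ofReal (Real.exp (v x / 2)) ∂μ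
      ≤ ∫⁻ x, ∑' k : ℕ, {x | (k : ℝ) ≤ v x}.indicator
          (fun _ => ENNReal.ofReal (Real.exp ((k + 1) / 2))) x ∂μ := by
        -- The single term $k=\lfloor v\rfloor$ of the series already dominates, since $v<k+1$.
        refine lintegral_mono fun x => le_trans ?_ (ENNReal.le_tsum ⌊v x⌋₊)
        rw [Set.indicator_of_mem (s := {y | (⌊v x⌋₊ : ℝ) ≤ v y}) (Nat.floor_le (hv0 x))]
        exact ENNReal.ofReal_le_ofReal (Real.exp_le_exp.2
          (div_le_div_of_nonneg_right (Nat.lt_floor_add_one _).le (by norm_num)))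
    _ = ∑' k : ℕ, ENNReal.ofReal (Real.exp ((k + 1) / 2)) * μ {x | (k : ℝ) ≤ v x} := by
        rw [lintegral_tsum fun k => (measurable_const.indicator (hmeas k)).aemeasurable]
        exact tsum_congr fun k => lintegral_indicator_const (hmeas k) _
    _ ≤ ∑' k : ℕ, ENNReal.ofReal (Real.exp ((1 - k) / 2)) * V := by
        refine ENNReal.tsum_le_tsum fun k => (mul_le_mul_right (h k) _).trans (le_of_eq ?_)
        rw [← mul_assoc, ← ENNReal.ofReal_mul (Real.exp_pos _).le, ← Real.exp_add]
        congr 4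
        ring
    _ = _ := ENNReal.tsum_mul_right

lemma tsum_exp_half_lt_top : ∑' k : ℕ, ENNReal.ofReal (Real.exp ((1 - k) / 2)) < ∞ := by
  have h1 : ∀ k : ℕ, Real.exp ((1 - (k : ℝ)) / 2) =
      Real.exp (1 / 2) * Real.exp (-(1 / 2)) ^ k := fun k => by
    rw [← Real.exp_nat_mul, ← Real.exp_add]
    congr 1
    ring
  have hs : Summable fun k : ℕ => Real.exp ((1 - (k : ℝ)) / 2) := by
    simp only [h1]
    exact (summable_geometric_of_lt_one (Real.exp_pos _).le
      ((Real.exp_lt_exp.2 (by norm_num)).trans_eq Real.exp_zero)).mul_left _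
  rw [← ENNReal.ofReal_tsum_of_nonneg (fun k => (Real.exp_pos _).le) hs]
  exact ENNReal.ofReal_lt_top

/-- The Trudinger inequality for test functions, with a small constant in the exponent. -/
lemma exists_trudinger (hn : 2 ≤ n) : ∃ A : ℝ, 0 < A ∧ ∀ (Ω : Set (E n)),
    MeasurableSet Ω → volume Ω ≠ ∞ → ∀ (φ : E n → ℝ), IsTestFunction Ω φ → ∀ G : ℝ, 0 < G →
    eLpNorm (gradient φ) n (volume.restrict Ω) ≤ ENNReal.ofReal G →
    ∫⁻ x in Ω, ENNReal.ofReal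
      (Real.exp ((|φ x| / (A * G)) ^ ((n : ℝ) / ((n : ℝ) - 1)) / 2)) ≤
      (∑' k : ℕ, ENNReal.ofReal (Real.exp ((1 - k) / 2))) * volume Ω := by
  obtain ⟨A, hA, H⟩ := exists_measureReal_superlevel_le_exp hn
  refine ⟨A, hA, fun Ω hΩm hΩ φ hφ G hG hGφ => ?_⟩
  have hn2 : (2 : ℝ) ≤ n := by exact_mod_cast hn
  have hn1 : (0 : ℝ) < (n : ℝ) - 1 := by linarith
  have hn0 : (0 : ℝ) < n := by linarith
  have hAG : 0 < A * G := by positivity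
  have hφm := hφ.smooth.continuous.measurable
  have hgrad : ∫ x in Ω, ‖gradient φ x‖ ^ n ≤ G ^ n := by
    have hm : AEStronglyMeasurable (fun x => ‖gradient φ x‖ ^ n) (volume.restrict Ω) :=
      (hφ.continuous_gradient.norm.pow n).aestronglyMeasurable
    rw [integral_eq_lintegral_of_nonneg_ae (Eventually.of_forall fun x => by positivity) hm]
    refine ENNReal.toReal_le_of_le_ofReal (by positivity) ?_
    rw [eLpNorm_eq_lintegral_rpow_enorm_toReal (by simp; omega) (by simp),
      ENNReal.toReal_natCast] at hGφ
    have h1 := ENNReal.rpow_le_rpow hGφ hn0.le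
    rw [← ENNReal.rpow_mul, one_div_mul_cancel hn0.ne', ENNReal.rpow_one, ENNReal.rpow_natCast,
      ← ENNReal.ofReal_pow hG.le] at h1
    refine le_of_eq_of_le (lintegral_congr fun x => ?_) h1
    rw [ENNReal.rpow_natCast, ← ofReal_norm, ENNReal.ofReal_pow (norm_nonneg _)]
  refine lintegral_exp_half_le _ ?_ (fun x => by positivity) fun k => ?_
  · exact (hφm.abs.div_const _).pow_const _
  · have hset : {x | (k : ℝ) ≤ (|φ x| / (A * G)) ^ ((n : ℝ) / ((n : ℝ) - 1))} ∩ Ω ⊆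
        {x ∈ Ω | A * G * (k : ℝ) ^ (((n : ℝ) - 1) / n) ≤ |φ x|} := by
      rintro x ⟨hx, hxΩ⟩
      refine ⟨hxΩ, ?_⟩
      have h1 := Real.rpow_le_rpow (by positivity) (Set.mem_ofPred_eq ▸ hx)
        (div_nonneg hn1.le hn0.le)
      rw [← Real.rpow_mul (by positivity), div_mul_div_cancel₀ hn1.ne', div_self hn0.ne',
        Real.rpow_one, le_div_iff₀ hAG] at h1
      linarith
    rw [Measure.restrict_apply' hΩm]
    have hfin : volume {x ∈ Ω | A * G * (k : ℝ) ^ (((n : ℝ) - 1) / n) ≤ |φ x|} ≠ ∞ :=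
      ne_top_of_le_ne_top hΩ (measure_mono fun x hx => hx.1)
    refine (measure_mono hset).trans ?_
    rw [← ENNReal.ofReal_toReal hfin, ← ENNReal.ofReal_toReal hΩ,
      ← ENNReal.ofReal_mul (Real.exp_pos _).le]
    exact ENNReal.ofReal_le_ofReal (H Ω hΩ φ hφ G hG hgrad k)

end Trudinger

/-! ### Exponential integrability with every constant -/

section Exponential

variable {n : ℕ} {Ω : Set (E n)}

lemma rpow_abs_le {p x y M : ℝ} (hp : 0 ≤ p) (hy : |y| ≤ M) :
    |x| ^ p ≤ 2 ^ p * (|x - y| ^ p + M ^ p) := by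
  have hM : 0 ≤ M := (abs_nonneg y).trans hy
  have h1 : |x| ≤ 2 * max |x - y| M := by
    have h2 : |x| ≤ |x - y| + |y| := by simpa using abs_add_le (x - y) y
    have h3 := le_max_left |x - y| M
    have h4 := le_max_right |x - y| M
    linarith
  refine (Real.rpow_le_rpow (abs_nonneg x) h1 hp).trans ?_
  rw [Real.mul_rpow (by norm_num) (hM.trans (le_max_right _ _))]
  gcongr
  have h5 := Real.rpow_nonneg (abs_nonneg (x - y)) p
  have h6 := Real.rpow_nonneg hM p
  rcases max_choice |x - y| M with h | h <;> rw [h] <;> linarith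

/-- Functions in `W₀^{1,n}(Ω)` are exponentially integrable with every constant. -/
lemma MemSobolevZero.integrableOn_exp (hn : 2 ≤ n) (hΩm : MeasurableSet Ω) (hΩ : volume Ω ≠ ∞)
    {u : E n → ℝ} {Du : E n → E n} (hu : MemSobolevZero Ω (n : ℝ≥0∞) u Du) {γ : ℝ} (hγ : 0 ≤ γ) :
    IntegrableOn (fun x => Real.exp (γ * |u x| ^ ((n : ℝ) / ((n : ℝ) - 1)))) Ω := by
  have : NeZero n := ⟨by omega⟩
  have : Fact (1 ≤ (n : ℝ≥0∞)) := ⟨by exact_mod_cast (by omega : 1 ≤ n)⟩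
  obtain ⟨A, hA, H⟩ := exists_trudinger hn
  obtain ⟨φ, hφ, hae, hgrad⟩ := hu.exists_ae_tendsto
  have hp := (holderConjugate hn).symm.pos
  set p : ℝ := (n : ℝ) / ((n : ℝ) - 1) with hpdef
  obtain ⟨D, hD0, hD⟩ : ∃ D : ℝ, 0 < D ∧ γ * 2 ^ p ≤ (1 / D) ^ p / 2 := by
    -- The solution of $D^{-p}=2(\gamma2^p+1)$; the $+1$ keeps $D$ well defined when $\gamma=0$. The
    -- gradient bound $G$ is then chosen so that Trudinger's inequality has scale $AG=D$.
    refine ⟨((2 * (γ * 2 ^ p + 1)) ^ (1 / p))⁻¹, by positivity, ?_⟩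
    rw [one_div, inv_inv, ← Real.rpow_mul (by positivity), one_div_mul_cancel hp.ne',
      Real.rpow_one]
    linarith
  set G : ℝ := D / A with hG
  have hG0 : 0 < G := by positivity
  have hAG : A * G = D := by rw [hG]; field_simp
  -- From $k_0$ on, two approximants differ by at most $G$ in gradient norm. The fixed
  -- $\varphi_{k_0}$ is the bounded part of $u$, and Trudinger's inequality is applied to
  -- $\varphi_k-\varphi_{k_0}$.
  obtain ⟨k₀, hk₀⟩ : ∃ k₀, ∀ k ≥ k₀, eLpNorm (fun x => gradient (φ k) x - Du x) n
      (volume.restrict Ω) ≤ ENNReal.ofReal (G / 2) :=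
    eventually_atTop.1 (hgrad.eventually_le_const (ENNReal.ofReal_pos.2 (by positivity)))
  obtain ⟨M, hM⟩ := (hφ k₀).hasCompactSupport.exists_bound_of_continuous
    (hφ k₀).smooth.continuous
  have hdiff : ∀ k ≥ k₀, eLpNorm (gradient fun x => φ k x - φ k₀ x) n (volume.restrict Ω) ≤
      ENNReal.ofReal G := by
    intro k hk
    have hsplit : (gradient fun x => φ k x - φ k₀ x) =
        (fun x => gradient (φ k) x - Du x) - fun x => gradient (φ k₀) x - Du x := by
      funext x
      rw [(hφ k).gradient_sub (hφ k₀)]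
      simp
    have hm : ∀ j, AEStronglyMeasurable (fun x => gradient (φ j) x - Du x)
        (volume.restrict Ω) := fun j =>
      (hφ j).continuous_gradient.aestronglyMeasurable.sub hu.memLp_grad.1
    rw [hsplit]
    refine (eLpNorm_sub_le (hm k) (hm k₀) Fact.out).trans ((add_le_add (hk₀ k hk)
      (hk₀ k₀ le_rfl)).trans (le_of_eq ?_))
    rw [← ENNReal.ofReal_add (by positivity) (by positivity), add_halves]
  set Q : ℝ≥0∞ := (∑' k : ℕ, ENNReal.ofReal (Real.exp ((1 - k) / 2))) * volume Ω with hQ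
  have hQfin : Q < ∞ := ENNReal.mul_lt_top tsum_exp_half_lt_top hΩ.lt_top
  have hcont : Continuous fun s : ℝ => ENNReal.ofReal (Real.exp ((|s| / D) ^ p / 2)) := by
    refine ENNReal.continuous_ofReal.comp (Real.continuous_exp.comp ?_)
    exact ((continuous_abs.div_const D).rpow_const fun _ => Or.inr hp.le).div_const 2
  have hFatou : ∫⁻ x in Ω, ENNReal.ofReal (Real.exp ((|u x - φ k₀ x| / D) ^ p / 2)) ≤ Q := by
    calc _ ≤ ∫⁻ x in Ω, liminf (fun k => ENNReal.ofReal
          (Real.exp ((|φ k x - φ k₀ x| / D) ^ p / 2))) atTop := by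
          refine lintegral_mono_ae ?_
          filter_upwards [hae] with x hx
          exact ((hcont.tendsto _).comp (hx.sub_const (φ k₀ x))).liminf_eq.ge
      _ ≤ liminf (fun k => ∫⁻ x in Ω, ENNReal.ofReal
          (Real.exp ((|φ k x - φ k₀ x| / D) ^ p / 2))) atTop :=
          lintegral_liminf_le fun k => hcont.measurable.comp
            ((hφ k).smooth.continuous.sub (hφ k₀).smooth.continuous).measurable
      _ ≤ liminf (fun _ => Q) atTop := by
          refine liminf_le_liminf ?_
          filter_upwards [eventually_ge_atTop k₀] with k hk
          have := H Ω hΩm hΩ _ ((hφ k).sub (hφ k₀)) G hG0 (hdiff k hk)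
          rwa [hAG] at this
      _ = Q := liminf_const Q
  have hint : Integrable (fun x => Real.exp ((|u x - φ k₀ x| / D) ^ p / 2))
      (volume.restrict Ω) := by
    have hm : AEStronglyMeasurable (fun x => u x - φ k₀ x) (volume.restrict Ω) :=
      hu.memLp.1.sub (hφ k₀).smooth.continuous.aestronglyMeasurable
    have hc : Continuous fun s : ℝ => Real.exp ((|s| / D) ^ p / 2) :=
      Real.continuous_exp.comp
        (((continuous_abs.div_const D).rpow_const fun _ => Or.inr hp.le).div_const 2)
    exact ⟨hc.comp_aestronglyMeasurable hm, (hasFiniteIntegral_iff_ofReal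
      (Eventually.of_forall fun x => (Real.exp_pos _).le)).2 (hFatou.trans_lt hQfin)⟩
  have hc' : Continuous fun s : ℝ => Real.exp (γ * |s| ^ p) :=
    Real.continuous_exp.comp
      (continuous_const.mul (continuous_abs.rpow_const fun _ => Or.inr hp.le))
  -- Splitting $|u|^p$ into the remainder and the bounded part puts the latter into a constant
  -- factor.
  refine (hint.const_mul (Real.exp (γ * (2 ^ p * M ^ p)))).mono'
    (hc'.comp_aestronglyMeasurable hu.memLp.1) (Eventually.of_forall fun x => ?_)
  rw [Real.norm_of_nonneg (Real.exp_pos _).le, ← Real.exp_add]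
  refine Real.exp_le_exp.2 ?_
  have h1 := mul_le_mul_of_nonneg_left
    (rpow_abs_le (x := u x) (y := φ k₀ x) hp.le (hM x)) hγ
  have h2 := mul_le_mul_of_nonneg_right hD (Real.rpow_nonneg (abs_nonneg (u x - φ k₀ x)) p)
  have h3 : (|u x - φ k₀ x| / D) ^ p = (1 / D) ^ p * |u x - φ k₀ x| ^ p := by
    rw [← Real.mul_rpow (by positivity) (abs_nonneg _), one_div_mul_eq_div]
  rw [h3]
  linarith

/-- The weight lies in $[0,1]$, so the unweighted integrand with constant $|\gamma|$ dominates, for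
either sign of $\gamma$. -/
lemma integrableOn_expIntegrand {F : E n → ℝ} {a : ℝ} {K : ℝ≥0} (hn : 2 ≤ n)
    (hN : IsLipschitzGauge (polar F) a K) (hΩm : MeasurableSet Ω) (hΩ : volume Ω ≠ ∞)
    (hlt : ∀ x ∈ Ω, polar F x < anisotropicRadius F Ω)
    {u : E n → ℝ} {Du : E n → E n} (hu : MemSobolevZero Ω (n : ℝ≥0∞) u Du) (γ : ℝ) :
    IntegrableOn (expIntegrand F Ω γ u) Ω := by
  have hp := (holderConjugate hn).symm.pos
  have hX : Measurable fun x => X₂ (polar F x / anisotropicRadius F Ω) ^ (1 / (n : ℝ)) :=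
    (measurable_X₂.comp (hN.measurable.div_const _)).pow_const _
  have hc : Continuous fun s : ℝ => Real.exp (γ * s ^ ((n : ℝ) / ((n : ℝ) - 1))) :=
    Real.continuous_exp.comp
      (continuous_const.mul (continuous_id.rpow_const fun _ => Or.inr hp.le))
  have hm : AEStronglyMeasurable (expIntegrand F Ω γ u) (volume.restrict Ω) :=
    hc.comp_aestronglyMeasurable (hu.memLp.1.norm.mul hX.aestronglyMeasurable)
  refine (hu.integrableOn_exp hn hΩm hΩ (abs_nonneg γ)).mono' hm ?_
  filter_upwards [ae_restrict_mem hΩm] with x hx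
  have h0 := hN.nonneg x
  have hx := hlt x hx
  obtain ⟨h1, h2⟩ := X₂_mem_Icc (div_nonneg h0 (h0.trans hx.le))
    ((div_le_one (h0.trans_lt hx)).2 hx.le)
  have h3 : X₂ (polar F x / anisotropicRadius F Ω) ^ (1 / (n : ℝ)) ≤ 1 :=
    Real.rpow_le_one h1 h2 (by positivity)
  have h4 : 0 ≤ X₂ (polar F x / anisotropicRadius F Ω) ^ (1 / (n : ℝ)) := Real.rpow_nonneg h1 _
  rw [expIntegrand, Real.norm_of_nonneg (Real.exp_pos _).le]
  refine Real.exp_le_exp.2 (mul_le_mul (le_abs_self γ) (Real.rpow_le_rpow (by positivity)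
    (mul_le_of_le_one_right (abs_nonneg _) h3) hp.le) (by positivity) (abs_nonneg _))

end Exponential

/-! ### The planar Euclidean constant -/

lemma polar_euclidean {n : ℕ} {F : E n → ℝ} (hF : ∀ ξ, F ξ = ‖ξ‖) (x : E n) :
    polar F x = ‖x‖ := by
  have hb : ∀ ξ : E n, F ξ ≤ 1 → inner ℝ ξ x ≤ ‖x‖ := fun ξ hξ => by
    rw [hF] at hξ
    exact (real_inner_le_norm ξ x).trans (mul_le_of_le_one_left (norm_nonneg x) hξ)
  apply le_antisymm
  · refine csSup_le ⟨_, 0, by simp [hF], rfl⟩ ?_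
    rintro _ ⟨ξ, hξ, rfl⟩
    exact hb ξ hξ
  · refine le_csSup ⟨‖x‖, ?_⟩ ⟨‖x‖⁻¹ • x, ?_, ?_⟩
    · rintro _ ⟨ξ, hξ, rfl⟩
      exact hb ξ hξ
    · rcases eq_or_ne x 0 with rfl | hx
      · simp [hF]
      · simp [hF, norm_smul, hx]
    · rcases eq_or_ne x 0 with rfl | hx
      · simp
      · have : ‖x‖ ≠ 0 := norm_ne_zero_iff.2 hx
        simp only [inner_smul_left, real_inner_self_eq_norm_sq]
        simp
        field_simp

lemma wulffVolume_euclidean_plane {F : E 2 → ℝ} (hF : ∀ ξ, F ξ = ‖ξ‖) :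
    wulffVolume F = Real.pi := by
  have : {x : E 2 | polar F x ≤ 1} = Metric.closedBall 0 1 := by
    ext x
    simp [polar_euclidean hF]
  rw [wulffVolume, this, measureReal_def, EuclideanSpace.volume_closedBall_fin_two]
  simp [Real.pi_pos.le]

/-- Here $\kappa_2=1$, the outer exponent is $1$ and the Wulff shape is the unit disc. With division
by zero equal to zero, the identity also covers $J_F[u]=0$. -/
lemma gammaBar_euclidean_plane {F : E 2 → ℝ} (hF : ∀ ξ, F ξ = ‖ξ‖) (Ω : Set (E 2))
    (u : E 2 → ℝ) (Du : E 2 → E 2) :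
    gammaBar F Ω u Du = 4 * Real.pi / radialHardyDifference F Ω u Du := by
  rw [gammaBar, wulffVolume_euclidean_plane hF, kappa]
  norm_num
  ring

end LerayTrudinger

theorem theorem3p4 (n : ℕ) (hn : 2 ≤ n)
    (F : LerayTrudinger.E n → ℝ) (hF : LerayTrudinger.IsStronglyConvexFinslerNorm F)
    (Ω : Set (LerayTrudinger.E n)) (hΩ_open : IsOpen Ω) (hΩ_conn : IsConnected Ω)
    (hΩ_bdd : Bornology.IsBounded Ω) (hΩ_zero : (0 : LerayTrudinger.E n) ∈ Ω)
    (u : LerayTrudinger.E n → ℝ) (Du : LerayTrudinger.E n → LerayTrudinger.E n)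
    (hu : LerayTrudinger.MemSobolevZero Ω (n : ENNReal) u Du)
    (hrad : LerayTrudinger.IsPolarRadial F Ω u) :
    -- the two integrals in `J_F[u]` converge, and `J_F[u] > 0` unless `u = 0`
    IntegrableOn (LerayTrudinger.radialEnergyDensity F Du) Ω ∧
    IntegrableOn (LerayTrudinger.hardyDensity F Ω u) Ω ∧
    (¬ (∀ᵐ x ∂(volume.restrict Ω), u x = 0) →
      0 < LerayTrudinger.radialHardyDifference F Ω u Du) ∧
    -- exponential integrability with the constant `γ̄`
    IntegrableOn
      (LerayTrudinger.expIntegrand F Ω (LerayTrudinger.gammaBar F Ω u Du) u) Ω ∧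
    -- the planar Euclidean case
    (n = 2 → (∀ ξ, F ξ = ‖ξ‖) →
      LerayTrudinger.gammaBar F Ω u Du =
        4 * Real.pi / LerayTrudinger.radialHardyDifference F Ω u Du ∧
      (LerayTrudinger.radialHardyDifference F Ω u Du ≤ 1 →
        IntegrableOn (LerayTrudinger.expIntegrand F Ω (4 * Real.pi) u) Ω)) := by
  have : NeZero n := ⟨by omega⟩
  obtain ⟨a, K, hN⟩ := hF.exists_isLipschitzGauge_polar hn
  have hlt : ∀ x ∈ Ω, LerayTrudinger.polar F x < LerayTrudinger.anisotropicRadius F Ω :=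
    fun x hx => LerayTrudinger.polar_lt_anisotropicRadius hN hΩ_open hΩ_bdd hx
  have hexp := LerayTrudinger.integrableOn_expIntegrand hn hN hΩ_open.measurableSet
    hΩ_bdd.measure_lt_top.ne hlt hu
  refine ⟨LerayTrudinger.integrable_radialEnergyDensity hN hu.memLp_grad,
    LerayTrudinger.integrableOn_hardyDensity hn hN hΩ_open.measurableSet hlt hΩ_zero hu,
    LerayTrudinger.radialHardyDifference_pos hn hN hΩ_open.measurableSet hlt hΩ_zero hu,
    hexp _, ?_⟩
  rintro rfl hFe
  exact ⟨LerayTrudinger.gammaBar_euclidean_plane hFe Ω u Du, fun _ => hexp _⟩
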